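/- Let $\mathcal G$ be an Abelian topological group with compact-open subgroups $\mathcal G_k$ ($k\in\mathbb Z$) such that $\mathcal G_k\subset\mathcal G_{k-1}$, $\bigcup_k\mathcal G_k=\mathcal G$, $\bigcap_k\mathcal G_k=\{0\}$ and $q_k:=|\mathcal G_k/\mathcal G_{k+1}|\ge 2$. Let $T$ be the tree whose vertices are the cosets $x+\mathcal G_k$ ($x\in\mathcal G$, $k\in\mathbb Z$), where $u=x+\mathcal G_k$ has predecessor $u'=x+\mathcal G_{k-1}$ and the edges are the pairs $\{u,u'\}$. Write $H_k$ for the set (horocycle) of cosets of $\mathcal G_k$, $o_k=\mathcal G_k\in H_k$, and $T_k$ for the set of vertices which have $o_k$, but not $o_{k+1}$, as an ancestor (a vertex being an ancestor of itself); every vertex lies in exactly one $T_k$. The set $\partial^*T$ of ends of $T$ other than the one represented by $(o_{-k})_{k\ge 0}$ is identified with $\mathcal G$: the point $x$ is the limit of the descending sequence $x+\mathcal G_k$, $k\to\infty$. For a vertex $u$, $\partial^*T_u\subset\partial^*T=\mathcal G$ is the coset $u$ itself. A sequence of vertices converges to $x\in\partial^*T$ if for every $k$ it eventually consists of vertices which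 have $x+\mathcal G_k$ as an ancestor. Let $F$ be a Borel measure on $\mathcal G$ (the Lévy measure) such that $a_k:=F(\mathcal G\setminus\mathcal G_k)$ satisfies $0<a_k<\infty$ for all $k\in\mathbb Z$ and $a_k\to\infty$ as $k\to\infty$, and put $f_k=a_k/a_{k+1}$. For a vertex $u\notin\{o_k:k\in\mathbb Z\}$ let $F(u)$ be the $F$-measure of the coset $u$, and let $F(o_k):=F(\mathcal G_k\setminus\mathcal G_{k+1})=a_{k+1}-a_k$. Consider the nearest-neighbour random walk on $T$ with transition probabilities $$p(u,u')=\frac{f_k}{1+f_k}\quad(u\in T_k),\qquad p(u',u)=\frac{F(u)}{F(u')}\cdot\frac1{1+f_k}\quad(u\in T_k\setminus\{o_k\},\ F(u')\neq 0),\qquad p(o_k,o_{k+1})=0,$$ where for $u\in T_k\setminus\{o_k\}$ with $F(u')=0$ one sets instead $p(u',u)=\frac1{q_k-1}\cdot\frac1{1+f_k}$ if $u'=o_k$, and $p(u',u)=\frac1{q_m}\cdot\frac1{1+f_k}$ if $u'\neq o_k$, $u'\in H_m$. Let $n\in\mathbb Z$. Then the random walk $(Z_m)_{m\ge 0}$ with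 these transition probabilities and $Z_0=o_{n-1}$ exists, it converges almost surely to a random variable $Z_\infty$ with values in $\partial^*T\setminus\{0\}$, and the distribution $\nu_n$ of $Z_\infty$ satisfies $$\nu_n(\partial^*T_u)=\frac{F(u)}{a_n}\qquad\text{for every } u\in H_n\setminus\{o_n\}.$$ -/

import Mathlib

open MeasureTheory Filter Topology

/-- A two-sided decreasing sequence of compact-open subgroups `𝒢 k` (`k ∈ ℤ`) of an Abelian
topological group, with union `G`, intersection `{0}` and `2 ≤ |𝒢 k / 𝒢 (k+1)| < ∞`. -/
structure BallFiltration (G : Type*) [AddCommGroup G] [TopologicalSpace G] where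
  sub : ℤ → AddSubgroup G
  isCompact : ∀ k, IsCompact (sub k : Set G)
  isOpen : ∀ k, IsOpen (sub k : Set G)
  le_pred : ∀ k, sub k ≤ sub (k - 1)
  iUnion_eq : ⋃ k, (sub k : Set G) = Set.univ
  iInter_eq : ⋂ k, (sub k : Set G) = {0}
  two_le_relIndex : ∀ k, 2 ≤ (sub (k + 1)).relIndex (sub k)

namespace BallFiltration

variable {G : Type*} [AddCommGroup G] [TopologicalSpace G] (𝒢 : BallFiltration G)

/-- The forward degree `q_k = |𝒢 k / 𝒢 (k+1)|` of the vertices in the `k`-th horocycle. -/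
noncomputable def q (k : ℤ) : ℕ := (𝒢.sub (k + 1)).relIndex (𝒢.sub k)

/-- The vertices of the tree: a vertex is a coset `x + 𝒢 k`, together with its level `k`. -/
def Vertex : Type _ := Σ k : ℤ, G ⧸ 𝒢.sub k

/-- The set of vertices (which is countable) carries the discrete σ-algebra. -/
instance : MeasurableSpace 𝒢.Vertex := ⊤

/-- The vertex `x + 𝒢 k`. For fixed `x` these are the vertices of the two-sided geodesic from the
reference end to the boundary point `x`. -/
def vertex (k : ℤ) (x : G) : 𝒢.Vertex := ⟨k, (x : G ⧸ 𝒢.sub k)⟩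

/-- The vertex `o_k`, that is, the subgroup `𝒢 k` itself. -/
def o (k : ℤ) : 𝒢.Vertex := 𝒢.vertex k 0

variable {𝒢}

/-- The horocycle number of a vertex. -/
def Vertex.hor (u : 𝒢.Vertex) : ℤ := u.1

/-- The predecessor of `x + 𝒢 k` is `x + 𝒢 (k-1)`. The edges of the tree join each vertex with its
predecessor. -/
def Vertex.pred (u : 𝒢.Vertex) : 𝒢.Vertex :=
  ⟨u.1 - 1, QuotientAddGroup.map (𝒢.sub u.1) (𝒢.sub (u.1 - 1)) (AddMonoidHom.id G)
    (𝒢.le_pred u.1) u.2⟩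

/-- `u.IsAncestor v`: the vertex `u` is `v` or an iterated predecessor of `v`. -/
def Vertex.IsAncestor (u v : 𝒢.Vertex) : Prop := ∃ j : ℕ, Vertex.pred^[j] v = u

/-- The boundary of the tree without the reference end is identified with the group `G`. This is
the set of the boundary points `x` for which `u` lies on the geodesic from the reference end
to `x`; it is the coset `u` as a subset of `G`. -/
def Vertex.ball (u : 𝒢.Vertex) : Set G := {x | 𝒢.vertex u.hor x = u}

variable (𝒢)

/-- The subtree `T_k`: the vertices which have `o_k`, but not `o_{k+1}`, as an ancestor. -/
def subtree (k : ℤ) : Set 𝒢.Vertex :=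
  {u | (𝒢.o k).IsAncestor u ∧ ¬ (𝒢.o (k + 1)).IsAncestor u}

variable {𝒢}

/-- The unique `k` with `u ∈ T_k`. -/
noncomputable def Vertex.branch (u : 𝒢.Vertex) : ℤ := sSup {k : ℤ | u ∈ 𝒢.subtree k}

variable (𝒢)

/-- Convergence of a sequence of vertices to the boundary point `x`: for each vertex on the geodesic
from the reference end to `x`, the sequence eventually stays in the branch below that vertex. -/
def ConvergesTo (z : ℕ → 𝒢.Vertex) (x : G) : Prop :=
  ∀ k : ℤ, ∀ᶠ m in atTop, (𝒢.vertex k x).IsAncestor (z m)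

variable [MeasurableSpace G]

/-- `a_k = F (G \ 𝒢 k)`. -/
noncomputable def a (F : Measure G) (k : ℤ) : ℝ := F.real ((𝒢.sub k : Set G)ᶜ)

/-- `f_k = a_k / a_{k+1}`. -/
noncomputable def ratio (F : Measure G) (k : ℤ) : ℝ := 𝒢.a F k / 𝒢.a F (k + 1)

open Classical in
/-- The vertex weights: the `F`-mass of the coset `u`, except for `u = o_k`, where it is
`F (𝒢 k \ 𝒢 (k+1))`. -/
noncomputable def weight (F : Measure G) (u : 𝒢.Vertex) : ℝ :=
  if u = 𝒢.o u.hor then F.real ((𝒢.sub u.hor : Set G) \ (𝒢.sub (u.hor + 1) : Set G))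
  else F.real u.ball

open Classical in
/-- The transition probabilities of the nearest neighbour random walk. A vertex `u` in `T_k` moves to
its predecessor with probability `f_k / (1 + f_k)`, and to its successors different from `o_{k+1}`
with total probability `1 / (1 + f_k)`, distributed proportionally to the weights, or uniformly when
`u` has weight `0`. It never moves from `o_k` to `o_{k+1}`. -/
noncomputable def p (F : Measure G) (u v : 𝒢.Vertex) : ℝ :=
  if v = u.pred then 𝒢.ratio F u.branch / (1 + 𝒢.ratio F u.branch)
  else if v.pred = u ∧ v ≠ 𝒢.o v.hor then
    if 𝒢.weight F u ≠ 0 then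
      𝒢.weight F v / 𝒢.weight F u * (1 / (1 + 𝒢.ratio F u.branch))
    else if u = 𝒢.o u.hor then
      1 / ((𝒢.q u.hor : ℝ) - 1) * (1 / (1 + 𝒢.ratio F u.branch))
    else
      1 / (𝒢.q u.hor : ℝ) * (1 / (1 + 𝒢.ratio F u.branch))
  else 0

open Classical in
/-- `Z` is (a realisation of) the random walk with the transition probabilities `p` that starts at
`s`: a Markov chain on the set of vertices, given by its finite-dimensional distributions. -/
structure IsWalk (F : Measure G) (s : 𝒢.Vertex) {Ω : Type*} [MeasurableSpace Ω]
    (ℙ : Measure Ω) (Z : ℕ → Ω → 𝒢.Vertex) : Prop where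
  isProbabilityMeasure : IsProbabilityMeasure ℙ
  measurable : ∀ m, Measurable (Z m)
  prob_path : ∀ (m : ℕ) (x : ℕ → 𝒢.Vertex),
    ℙ.real {ω | ∀ i ≤ m, Z i ω = x i} =
      if x 0 = s then ∏ i ∈ Finset.range m, 𝒢.p F (x i) (x (i + 1)) else 0

/-- The random boundary point `Y` is the almost sure limit of the sequence `Z` of random vertices. -/
structure IsBoundaryLimit {Ω : Type*} [MeasurableSpace Ω] (ℙ : Measure Ω)
    (Z : ℕ → Ω → 𝒢.Vertex) (Y : Ω → G) : Prop where
  measurable : Measurable Y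
  ae_converges : ∀ᵐ ω ∂ℙ, 𝒢.ConvergesTo (fun m => Z m ω) (Y ω)

end BallFiltration

set_option linter.unusedSectionVars false

namespace BallFiltration

/-! ### Ancestors, subtrees and balls in the tree -/

section Geometry

variable {G : Type*} [AddCommGroup G] [TopologicalSpace G] {𝒢 : BallFiltration G}

/-! Since `o k` never moves to `o (k + 1)`, the index `branch` of the subtree that contains the walk
never increases, and a new subtree T_k is entered only at `o k`. Inside T_k the distance from `o k`
is a nearest-neighbour walk on the half-line, stepping inwards and outwards with odds f_k : 1 where
f_k ≤ 1. Gambler's ruin gives f_k as the probability of ever leaving T_k through `o k`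
(`IsWalk.measureReal_exists_branch_le_pred`). The product of the f_j telescopes, so the walk gets
down to T_k or lower with probability a_{k+1}/a_n (`IsWalk.measureReal_exists_branch_le`). Hence it
ends in T_k with probability (a_{k+1} - a_k)/a_n, and since a_k → 0 as k → -∞ it almost surely ends
in some T_k.

Outward steps choose among the children in proportion to their weights, so at every time and on
every horocycle the position within T_k is distributed in proportion to the weights
(`IsWalk.weight_mul_measure_descendants`). The share of u in T_k is therefore F(u)/F(o_k), and
multiplication by F(o_k)/a_n gives F(u)/a_n.

For convergence, each level of each T_k is visited only finitely often
(`IsWalk.ae_eventually_le_hor`), so the horocycle numbers tend to infinity, and compactness of the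
balls yields a limit point (`exists_convergesTo`).

No stopping times occur. Everything is an identity or inequality for the law of `Z m` at a fixed
time, followed by m → ∞ (`IsWalk.tendsto_measureReal`); gambler's ruin is replaced by the harmonic
function `geomFun`. -/

lemma sub_anti : Antitone 𝒢.sub :=
  antitone_int_of_succ_le fun k => by simpa using 𝒢.le_pred (k + 1)

lemma vertex_eq_iff {k : ℤ} {x y : G} : 𝒢.vertex k x = 𝒢.vertex k y ↔ x - y ∈ 𝒢.sub k := by
  rw [← neg_add_eq_sub, ← QuotientAddGroup.eq, eq_comm]
  exact ⟨fun h => eq_of_heq (Sigma.mk.inj h).2, fun h => congrArg (Sigma.mk k) h⟩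

@[simp] lemma hor_vertex (k : ℤ) (x : G) : (𝒢.vertex k x).hor = k := rfl

@[simp] lemma hor_o (k : ℤ) : (𝒢.o k).hor = k := rfl

lemma exists_eq_vertex (u : 𝒢.Vertex) : ∃ x, u = 𝒢.vertex u.hor x := by
  obtain ⟨k, x⟩ := u
  obtain ⟨x, rfl⟩ := QuotientAddGroup.mk_surjective x
  exact ⟨x, rfl⟩

lemma vertex_eq_vertex_iff {k m : ℤ} {x y : G} :
    𝒢.vertex k x = 𝒢.vertex m y ↔ k = m ∧ x - y ∈ 𝒢.sub k := by
  constructor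
  · intro h
    obtain rfl : k = m := congrArg Vertex.hor h
    exact ⟨rfl, vertex_eq_iff.1 h⟩
  · rintro ⟨rfl, h⟩
    exact vertex_eq_iff.2 h

@[simp] lemma pred_vertex (k : ℤ) (x : G) : (𝒢.vertex k x).pred = 𝒢.vertex (k - 1) x := rfl

@[simp] lemma pred_o (k : ℤ) : (𝒢.o k).pred = 𝒢.o (k - 1) := rfl

@[simp] lemma hor_pred (u : 𝒢.Vertex) : u.pred.hor = u.hor - 1 := rfl

lemma pred_iterate_vertex (k : ℤ) (x : G) (j : ℕ) :
    Vertex.pred^[j] (𝒢.vertex k x) = 𝒢.vertex (k - j) x := by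
  induction j with
  | zero => simp
  | succ j ih =>
    rw [Function.iterate_succ_apply', ih, pred_vertex]
    congr 1
    push_cast
    ring

lemma isAncestor_vertex_iff {k m : ℤ} {x y : G} :
    (𝒢.vertex k x).IsAncestor (𝒢.vertex m y) ↔ k ≤ m ∧ y - x ∈ 𝒢.sub k := by
  simp only [Vertex.IsAncestor, pred_iterate_vertex, vertex_eq_vertex_iff]
  constructor
  · rintro ⟨j, rfl, h⟩
    exact ⟨by omega, h⟩
  · rintro ⟨h, h'⟩
    refine ⟨(m - k).toNat, by omega, ?_⟩
    rwa [Int.toNat_of_nonneg (by omega), sub_sub_cancel]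

lemma o_isAncestor_vertex_iff {k m : ℤ} {y : G} :
    (𝒢.o k).IsAncestor (𝒢.vertex m y) ↔ k ≤ m ∧ y ∈ 𝒢.sub k := by
  rw [o, isAncestor_vertex_iff, sub_zero]

lemma isAncestor_refl (u : 𝒢.Vertex) : u.IsAncestor u := ⟨0, rfl⟩

lemma Vertex.IsAncestor.hor_le {u v : 𝒢.Vertex} (h : u.IsAncestor v) : u.hor ≤ v.hor := by
  obtain ⟨x, hx⟩ := exists_eq_vertex u
  obtain ⟨y, hy⟩ := exists_eq_vertex v
  rw [hx, hy, isAncestor_vertex_iff] at h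
  exact h.1

lemma isAncestor_trans {u v w : 𝒢.Vertex} (h : u.IsAncestor v) (h' : v.IsAncestor w) :
    u.IsAncestor w := by
  obtain ⟨i, rfl⟩ := h
  obtain ⟨j, rfl⟩ := h'
  exact ⟨i + j, Function.iterate_add_apply _ _ _ _⟩

lemma isAncestor_pred_iff {u v : 𝒢.Vertex} (h : u.hor < v.hor) :
    u.IsAncestor v.pred ↔ u.IsAncestor v := by
  obtain ⟨x, hx⟩ := exists_eq_vertex u
  obtain ⟨y, hy⟩ := exists_eq_vertex v
  rw [hx, hy, pred_vertex, isAncestor_vertex_iff, isAncestor_vertex_iff]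
  constructor <;> rintro ⟨-, h2⟩ <;> exact ⟨by omega, h2⟩

lemma isAncestor_iff_eq {u v : 𝒢.Vertex} (h : u.hor = v.hor) : u.IsAncestor v ↔ u = v := by
  refine ⟨?_, by rintro rfl; exact isAncestor_refl _⟩
  obtain ⟨x, hx⟩ := exists_eq_vertex u
  obtain ⟨y, hy⟩ := exists_eq_vertex v
  rw [hx, hy, h, isAncestor_vertex_iff, vertex_eq_iff]
  rintro ⟨-, h2⟩
  simpa using neg_mem h2

lemma eq_of_isAncestor {u v w : 𝒢.Vertex} (h : u.hor = v.hor) (hu : u.IsAncestor w)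
    (hv : v.IsAncestor w) : u = v := by
  obtain ⟨x, hx⟩ := exists_eq_vertex u
  obtain ⟨y, hy⟩ := exists_eq_vertex v
  obtain ⟨z, hz⟩ := exists_eq_vertex w
  rw [hx, hz, isAncestor_vertex_iff] at hu
  rw [hy, hz, isAncestor_vertex_iff, ← h] at hv
  rw [hx, hy, ← h, vertex_eq_iff]
  simpa using sub_mem hv.2 hu.2

lemma mem_subtree_iff {k m : ℤ} {x : G} :
    𝒢.vertex m x ∈ 𝒢.subtree k ↔
      (k ≤ m ∧ x ∈ 𝒢.sub k) ∧ ¬ (k + 1 ≤ m ∧ x ∈ 𝒢.sub (k + 1)) := by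
  simp only [subtree, Set.mem_ofPred_eq, o_isAncestor_vertex_iff]

lemma exists_mem_sub (x : G) : ∃ k, x ∈ 𝒢.sub k := by
  have := 𝒢.iUnion_eq.symm ▸ Set.mem_univ x
  simpa using this

/-- The indices k for which `o k` is an ancestor of u are bounded by the level of u, and exist
because the subgroups exhaust the group; the greatest of them works. -/
lemma exists_mem_subtree (u : 𝒢.Vertex) : ∃ k, u ∈ 𝒢.subtree k := by
  obtain ⟨x, hx⟩ := exists_eq_vertex u
  obtain ⟨j, hj⟩ := exists_mem_sub (𝒢 := 𝒢) x
  obtain ⟨k, ⟨h1, h2⟩, h3⟩ := Int.exists_greatest_of_bdd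
    (P := fun k => k ≤ u.hor ∧ x ∈ 𝒢.sub k) ⟨u.hor, fun k hk => hk.1⟩
    ⟨min j u.hor, min_le_right _ _, sub_anti (min_le_left _ _) hj⟩
  refine ⟨k, ?_⟩
  rw [hx, mem_subtree_iff]
  exact ⟨⟨h1, h2⟩, fun h => by have := h3 _ h; omega⟩

lemma subtree_unique {u : 𝒢.Vertex} {k l : ℤ} (hk : u ∈ 𝒢.subtree k) (hl : u ∈ 𝒢.subtree l) :
    k = l := by
  obtain ⟨x, hx⟩ := exists_eq_vertex u
  rw [hx, mem_subtree_iff] at hk hl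
  by_contra hne
  rcases lt_or_gt_of_ne hne with h | h
  · exact hk.2 ⟨by omega, sub_anti (by omega) hl.1.2⟩
  · exact hl.2 ⟨by omega, sub_anti (by omega) hk.1.2⟩

/-- The supremum defining `branch` is taken over a one-point set, so its default value never occurs.
-/
lemma branch_eq_iff {u : 𝒢.Vertex} {k : ℤ} : u.branch = k ↔ u ∈ 𝒢.subtree k := by
  obtain ⟨l, hl⟩ := exists_mem_subtree u
  have : {k : ℤ | u ∈ 𝒢.subtree k} = {l} := by
    ext k
    exact ⟨fun h => subtree_unique h hl, by rintro rfl; exact hl⟩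
  rw [Vertex.branch, this, csSup_singleton]
  exact ⟨by rintro rfl; exact hl, fun h => subtree_unique hl h⟩

lemma branch_vertex_eq_iff {k m : ℤ} {x : G} : (𝒢.vertex m x).branch = k ↔
    (k ≤ m ∧ x ∈ 𝒢.sub k) ∧ ¬ (k + 1 ≤ m ∧ x ∈ 𝒢.sub (k + 1)) := by
  rw [branch_eq_iff, mem_subtree_iff]

@[simp] lemma branch_o (k : ℤ) : (𝒢.o k).branch = k := by
  rw [o, branch_vertex_eq_iff]
  exact ⟨⟨le_rfl, zero_mem _⟩, fun h => by omega⟩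

lemma o_isAncestor_iff {k : ℤ} {u : 𝒢.Vertex} : (𝒢.o k).IsAncestor u ↔ k ≤ u.branch := by
  obtain ⟨x, hx⟩ := exists_eq_vertex u
  obtain ⟨h1, h2⟩ := branch_vertex_eq_iff.1 (congrArg Vertex.branch hx).symm
  rw [hx, ← hx, hx, o_isAncestor_vertex_iff, ← hx]
  constructor
  · rintro ⟨h3, h4⟩
    by_contra! h
    exact h2 ⟨by omega, sub_anti (by omega) h4⟩
  · intro h
    exact ⟨by omega, sub_anti h h1.2⟩

lemma branch_le_hor (u : 𝒢.Vertex) : u.branch ≤ u.hor :=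
  (o_isAncestor_iff.2 le_rfl).hor_le

lemma branch_eq_hor_iff {u : 𝒢.Vertex} : u.branch = u.hor ↔ u = 𝒢.o u.hor := by
  constructor
  · intro h
    exact ((isAncestor_iff_eq (hor_o _)).1 (o_isAncestor_iff.2 h.ge)).symm
  · intro h
    rw [h, branch_o, hor_o]

lemma branch_pred {u : 𝒢.Vertex} (h : u ≠ 𝒢.o u.hor) : u.pred.branch = u.branch := by
  have h' : u.branch < u.hor := lt_of_le_of_ne (branch_le_hor u) (mt branch_eq_hor_iff.1 h)
  refine eq_of_forall_le_iff fun k => ?_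
  rw [← o_isAncestor_iff, ← o_isAncestor_iff]
  by_cases hk : k < u.hor
  · exact isAncestor_pred_iff (by simpa using hk)
  · constructor <;> intro h3
    · have := h3.hor_le; simp at this; omega
    · have := o_isAncestor_iff.1 h3; omega

lemma branch_pred_of_eq {u : 𝒢.Vertex} (h : u.branch = u.hor) : u.pred.branch = u.branch - 1 := by
  have h' := branch_eq_hor_iff.1 h
  rw [h, h', pred_o, branch_o, hor_o]

lemma mem_ball_iff {u : 𝒢.Vertex} {x : G} : x ∈ u.ball ↔ 𝒢.vertex u.hor x = u := Iff.rfl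

lemma mem_ball_vertex {k : ℤ} {x y : G} : y ∈ (𝒢.vertex k x).ball ↔ y - x ∈ 𝒢.sub k := by
  rw [mem_ball_iff, hor_vertex, vertex_eq_iff]

lemma ball_o (k : ℤ) : (𝒢.o k).ball = 𝒢.sub k := by
  ext y
  rw [o, mem_ball_vertex, sub_zero, SetLike.mem_coe]

lemma mem_ball_iff_isAncestor {u : 𝒢.Vertex} {x : G} {m : ℤ} (h : u.hor ≤ m) :
    x ∈ u.ball ↔ u.IsAncestor (𝒢.vertex m x) := by
  obtain ⟨y, hy⟩ := exists_eq_vertex u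
  rw [hy, mem_ball_vertex, isAncestor_vertex_iff]
  exact ⟨fun h' => ⟨h, h'⟩, fun h' => h'.2⟩

lemma ball_subset_of_branch_eq {u : 𝒢.Vertex} (h : u ≠ 𝒢.o u.hor) :
    u.ball ⊆ (𝒢.sub u.branch : Set G) \ (𝒢.sub (u.branch + 1) : Set G) := by
  intro y hy
  have h' : u.branch < u.hor := lt_of_le_of_ne (branch_le_hor u) (mt branch_eq_hor_iff.1 h)
  obtain ⟨h1, h2⟩ := branch_vertex_eq_iff.1 (congrArg Vertex.branch (mem_ball_iff.1 hy))
  exact ⟨h1.2, fun h3 => h2 ⟨by omega, h3⟩⟩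

/-- The vertices with predecessor `u`, other than those of the form `o k`. -/
def children (u : 𝒢.Vertex) : Set 𝒢.Vertex := {v | v.pred = u ∧ v ≠ 𝒢.o v.hor}

lemma hor_of_pred_eq {u v : 𝒢.Vertex} (h : v.pred = u) : v.hor = u.hor + 1 := by
  rw [← h, hor_pred]; ring

lemma branch_of_mem_children {u v : 𝒢.Vertex} (h : v ∈ children u) : v.branch = u.branch := by
  rw [← branch_pred h.2, h.1]

lemma hor_of_mem_children {u v : 𝒢.Vertex} (h : v ∈ children u) : v.hor = u.hor + 1 :=
  hor_of_pred_eq h.1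

lemma mem_children_iff {u v : 𝒢.Vertex} :
    v ∈ children u ↔ ∃ x ∈ u.ball, v = 𝒢.vertex (u.hor + 1) x ∧ v ≠ 𝒢.o (u.hor + 1) := by
  constructor
  · intro h
    obtain ⟨x, hx⟩ := exists_eq_vertex v
    have h1 := hor_of_mem_children h
    refine ⟨x, ?_, h1 ▸ hx, h1 ▸ h.2⟩
    rw [mem_ball_iff, ← h.1, hx, pred_vertex, hor_vertex]
  · rintro ⟨x, hx, rfl, h⟩
    exact ⟨by rw [pred_vertex, add_sub_cancel_right]; exact hx, h⟩

lemma ne_o_of_mem_children {u v : 𝒢.Vertex} (h : v ∈ children u) : v ≠ 𝒢.o (u.hor + 1) :=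
  hor_of_mem_children h ▸ h.2

/-- The part of the ball of `u` which is covered by the balls of the `children`. -/
def shell (u : 𝒢.Vertex) : Set G := u.ball \ {x | 𝒢.vertex (u.hor + 1) x = 𝒢.o (u.hor + 1)}

lemma shell_o (k : ℤ) : shell (𝒢.o k) = (𝒢.sub k : Set G) \ (𝒢.sub (k + 1) : Set G) := by
  ext x
  rw [shell, ball_o, Set.mem_sdiff, Set.mem_sdiff, Set.mem_ofPred_eq, hor_o, o, vertex_eq_iff, sub_zero]
  rfl

lemma shell_of_ne {u : 𝒢.Vertex} (h : u ≠ 𝒢.o u.hor) : shell u = u.ball := by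
  refine sdiff_eq_left.2 (Set.disjoint_left.2 fun x hx hx' => h ?_)
  rw [← mem_ball_iff.1 hx, hor_vertex]
  have := congrArg Vertex.pred hx'
  simpa using this

lemma shell_eq_iUnion (u : 𝒢.Vertex) : shell u = ⋃ v ∈ children u, v.ball := by
  ext x
  simp only [Set.mem_iUnion, exists_prop]
  constructor
  · rintro ⟨h1, h2⟩
    exact ⟨_, mem_children_iff.2 ⟨x, h1, rfl, h2⟩, by rw [mem_ball_iff, hor_vertex]⟩
  · rintro ⟨v, hv, hx⟩
    rw [mem_ball_iff, hor_of_mem_children hv] at hx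
    refine ⟨?_, fun h => ne_o_of_mem_children hv (hx ▸ h)⟩
    rw [mem_ball_iff, ← hv.1, ← hx, pred_vertex, hor_vertex]

lemma pairwiseDisjoint_ball_children (u : 𝒢.Vertex) :
    (children u).PairwiseDisjoint Vertex.ball := by
  intro v hv w hw hvw
  refine Set.disjoint_left.2 fun x hx hx' => hvw ?_
  rw [mem_ball_iff, hor_of_mem_children hv] at hx
  rw [mem_ball_iff, hor_of_mem_children hw] at hx'
  exact hx.symm.trans hx'

/-- The vertices with predecessor `u` are counted by the cosets of `𝒢 (k+1)` in `𝒢 k`. -/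
lemma ncard_pred_fiber (u : 𝒢.Vertex) : {v : 𝒢.Vertex | v.pred = u}.ncard = 𝒢.q u.hor := by
  obtain ⟨x, hx⟩ := exists_eq_vertex u
  set k := u.hor with hk
  have hle : 𝒢.sub (k + 1) ≤ 𝒢.sub k := sub_anti (by omega)
  let φ : (𝒢.sub k ⧸ (𝒢.sub (k + 1)).addSubgroupOf (𝒢.sub k)) → {v : 𝒢.Vertex | v.pred = u} :=
    Quotient.lift (fun y => ⟨𝒢.vertex (k + 1) (y + x), by
      rw [Set.mem_ofPred_eq, pred_vertex, add_sub_cancel_right, hx, vertex_eq_iff]; simp⟩)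
      (fun y z h => by
        rw [Subtype.mk.injEq, eq_comm, vertex_eq_iff]
        have := QuotientAddGroup.leftRel_apply.1 h
        rw [AddSubgroup.mem_addSubgroupOf] at this
        convert this using 1
        push_cast
        abel)
  have hφ : Function.Bijective φ := by
    constructor
    · intro y z
      obtain ⟨y, rfl⟩ := QuotientAddGroup.mk_surjective y
      obtain ⟨z, rfl⟩ := QuotientAddGroup.mk_surjective z
      intro h
      have h1 : 𝒢.vertex (k + 1) (y + x) = 𝒢.vertex (k + 1) (z + x) := congrArg Subtype.val h
      rw [eq_comm, vertex_eq_iff] at h1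
      rw [QuotientAddGroup.eq, AddSubgroup.mem_addSubgroupOf]
      convert h1 using 1
      push_cast
      abel
    · rintro ⟨v, hv⟩
      obtain ⟨z, hz⟩ := exists_eq_vertex v
      have h1 : v.hor = k + 1 := hor_of_pred_eq hv
      rw [h1] at hz
      have h2 : z - x ∈ 𝒢.sub k := by
        rw [Set.mem_ofPred_eq, hz, hx, pred_vertex, add_sub_cancel_right, vertex_eq_iff] at hv
        exact hv
      refine ⟨QuotientAddGroup.mk ⟨z - x, h2⟩, Subtype.ext ?_⟩
      change 𝒢.vertex (k + 1) (z - x + x) = v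
      rw [hz, sub_add_cancel]
  rw [← Nat.card_coe_set_eq, ← Nat.card_congr (Equiv.ofBijective φ hφ)]
  rfl

lemma finite_pred_fiber (u : 𝒢.Vertex) : {v : 𝒢.Vertex | v.pred = u}.Finite := by
  refine Set.finite_of_ncard_ne_zero ?_
  rw [ncard_pred_fiber]
  have := 𝒢.two_le_relIndex u.hor
  rw [q]; omega

lemma finite_children (u : 𝒢.Vertex) : (children u).Finite :=
  (finite_pred_fiber u).subset fun _ h => h.1

lemma ncard_children_of_ne {u : 𝒢.Vertex} (h : u ≠ 𝒢.o u.hor) : (children u).ncard = 𝒢.q u.hor := by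
  rw [← ncard_pred_fiber]
  congr 1
  ext v
  refine ⟨fun h => h.1, fun hv => ⟨hv, fun h' => h ?_⟩⟩
  rw [Set.mem_ofPred_eq] at hv
  rw [← hv, h', pred_o, hor_o]

lemma ncard_children_o (k : ℤ) : (children (𝒢.o k)).ncard = 𝒢.q k - 1 := by
  have h : children (𝒢.o k) = {v : 𝒢.Vertex | v.pred = 𝒢.o k} \ {𝒢.o (k + 1)} := by
    ext v
    constructor
    · intro h
      exact ⟨h.1, ne_o_of_mem_children h⟩
    · rintro ⟨h1, h2⟩
      refine ⟨h1, ?_⟩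
      rwa [hor_of_pred_eq h1]
  rw [h, Set.ncard_sdiff_singleton_of_mem (by simp), ncard_pred_fiber, hor_o]

/-- Once a descending path has left the line of the `o k`, it cannot return to it. -/
lemma branch_eq_branch_of_isAncestor {u v : 𝒢.Vertex} (h : u.IsAncestor v)
    (hu : u ≠ 𝒢.o u.hor) : v.branch = u.branch := by
  have h' : u.branch < u.hor := lt_of_le_of_ne (branch_le_hor u) (mt branch_eq_hor_iff.1 hu)
  refine le_antisymm ?_ (o_isAncestor_iff.1 (isAncestor_trans (o_isAncestor_iff.2 le_rfl) h))
  by_contra! hlt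
  have h1 : (𝒢.o (u.branch + 1)).IsAncestor v := o_isAncestor_iff.2 hlt
  obtain ⟨x, hx⟩ := exists_eq_vertex u
  obtain ⟨y, hy⟩ := exists_eq_vertex v
  rw [hx, hy, isAncestor_vertex_iff] at h
  rw [hy, o_isAncestor_vertex_iff] at h1
  have h2 := (branch_vertex_eq_iff.1 (congrArg Vertex.branch hx).symm).2
  refine h2 ⟨by omega, ?_⟩
  have h3 : y - x ∈ 𝒢.sub (u.branch + 1) := sub_anti (by omega) h.2
  simpa using sub_mem h1.2 h3

/-- A vertex has at most one ancestor on each horocycle. This turns the position of the limit into a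
tail event of the sequence. -/
lemma convergesTo_iff {z : ℕ → 𝒢.Vertex} {x : G} (hx : 𝒢.ConvergesTo z x) (u : 𝒢.Vertex) :
    x ∈ u.ball ↔ ∀ᶠ m in atTop, u.IsAncestor (z m) := by
  constructor
  · intro h
    rw [← mem_ball_iff.1 h]
    exact hx _
  · intro h
    obtain ⟨m, h1, h2⟩ := (h.and (hx u.hor)).exists
    exact (eq_of_isAncestor (hor_vertex _ _).symm h1 h2).symm

/-! ### Countability, the topology of the balls, and limits of vertex sequences -/

section Topological

variable [IsTopologicalAddGroup G]

instance : DiscreteMeasurableSpace 𝒢.Vertex := ⟨fun _ => trivial⟩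

instance countable_quotient (k : ℤ) : Countable (G ⧸ 𝒢.sub k) := by
  have : DiscreteTopology (G ⧸ 𝒢.sub k) := QuotientAddGroup.discreteTopology (𝒢.isOpen k)
  have h : (Set.univ : Set (G ⧸ 𝒢.sub k)) =
      ⋃ j : ℤ, QuotientAddGroup.mk '' (𝒢.sub j : Set G) := by
    rw [← Set.image_iUnion, 𝒢.iUnion_eq, Set.image_univ]
    exact QuotientAddGroup.mk_surjective.range_eq.symm
  rw [← Set.countable_univ_iff, h]
  refine Set.countable_iUnion fun j => Set.Finite.countable ?_
  exact isCompact_iff_finite.1 ((𝒢.isCompact j).image continuous_quotient_mk')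

instance : Countable 𝒢.Vertex := inferInstanceAs (Countable (Σ k : ℤ, G ⧸ 𝒢.sub k))

lemma isOpen_ball (u : 𝒢.Vertex) : IsOpen u.ball := by
  obtain ⟨x, hx⟩ := exists_eq_vertex u
  have : u.ball = (fun y => y - x) ⁻¹' (𝒢.sub u.hor) := by
    ext y
    rw [hx, mem_ball_vertex]; rfl
  rw [this]
  exact (𝒢.isOpen _).preimage (by fun_prop)

lemma isCompact_ball (u : 𝒢.Vertex) : IsCompact u.ball := by
  obtain ⟨x, hx⟩ := exists_eq_vertex u
  have : u.ball = (fun y => y + x) '' (𝒢.sub u.hor) := by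
    ext y
    rw [hx, mem_ball_vertex, Set.image_add_right]
    simp [sub_eq_add_neg]
  rw [this]
  exact (𝒢.isCompact _).image (by fun_prop)

lemma isClosed_sub (k : ℤ) : IsClosed (𝒢.sub k : Set G) :=
  AddSubgroup.isClosed_of_isOpen _ (𝒢.isOpen k)

lemma isClosed_ball (u : 𝒢.Vertex) : IsClosed u.ball := by
  obtain ⟨x, hx⟩ := exists_eq_vertex u
  have : u.ball = (fun y => y - x) ⁻¹' (𝒢.sub u.hor) := by
    ext y
    rw [hx, mem_ball_vertex]; rfl
  rw [this]
  exact (isClosed_sub _).preimage (by fun_prop)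

/-- The balls form a base of the topology. -/
lemma exists_ball_subset {U : Set G} (hU : IsOpen U) {x : G} (hx : x ∈ U) :
    ∃ k, (𝒢.vertex k x).ball ⊆ U := by
  -- The balls around x are compact and decrease to {x}, so one of them lies in the neighbourhood.
  have := exists_subset_nhds_of_isCompact' (V := fun k : ℤ => (𝒢.vertex k x).ball) (U := U)
    (Antitone.directed_ge fun i j hij y hy => by
      rw [mem_ball_vertex] at hy ⊢
      exact sub_anti hij hy)
    (fun _ => isCompact_ball _) (fun _ => isClosed_ball _) ?_
  · exact this
  · intro y hy
    have h0 : y - x ∈ ⋂ k, (𝒢.sub k : Set G) := by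
      simpa [mem_ball_vertex] using hy
    rw [𝒢.iInter_eq, Set.mem_singleton_iff, sub_eq_zero] at h0
    rw [h0]
    exact hU.mem_nhds hx

lemma eq_iUnion_ball {U : Set G} (hU : IsOpen U) :
    U = ⋃ u ∈ {u : 𝒢.Vertex | u.ball ⊆ U}, u.ball := by
  refine subset_antisymm (fun x hx => ?_) (Set.iUnion₂_subset fun u hu => hu)
  obtain ⟨k, hk⟩ := exists_ball_subset (𝒢 := 𝒢) hU hx
  exact Set.mem_biUnion (show 𝒢.vertex k x ∈ _ from hk) (by rw [mem_ball_iff, hor_vertex])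

/-- There are only countably many balls and they form a base, so they generate the Borel sets. -/
lemma measurable_of_ball [MeasurableSpace G] [BorelSpace G] {Ω : Type*} [MeasurableSpace Ω]
    {Y : Ω → G} (h : ∀ u : 𝒢.Vertex, MeasurableSet (Y ⁻¹' u.ball)) : Measurable Y := by
  refine measurable_of_isOpen fun U hU => ?_
  rw [eq_iUnion_ball (𝒢 := 𝒢) hU, Set.preimage_iUnion₂]
  exact MeasurableSet.biUnion (Set.to_countable _) fun u _ => h u

/-- A sequence of vertices whose horocycle numbers tend to `∞` and which moves between neighbours
converges to a boundary point. -/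
lemma exists_convergesTo {z : ℕ → 𝒢.Vertex} (hz : Tendsto (fun m => (z m).hor) atTop atTop)
    (hn : ∀ m, z (m + 1) = (z m).pred ∨ (z (m + 1)).pred = z m) : ∃ x, 𝒢.ConvergesTo z x := by
  -- Once the sequence stays at levels at least k, a step to a neighbour cannot change the ancestor
  -- at level k. The balls of these limiting ancestors are nested, nonempty and compact, and any
  -- common point is a limit.
  have key : ∀ k : ℤ, ∃ u : 𝒢.Vertex, u.hor = k ∧ ∀ᶠ m in atTop, u.IsAncestor (z m) := by
    intro k
    obtain ⟨M, hM⟩ := eventually_atTop.1 (hz.eventually_ge_atTop k)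
    obtain ⟨x, hx⟩ := exists_eq_vertex (z M)
    refine ⟨𝒢.vertex k x, rfl, eventually_atTop.2 ⟨M, fun m hm => ?_⟩⟩
    induction m, hm using Nat.le_induction with
    | base =>
      rw [hx, isAncestor_vertex_iff, sub_self]
      exact ⟨hM _ le_rfl, zero_mem _⟩
    | succ m hm ih =>
      have h1 := hM m hm
      have h2 := hM (m + 1) (by omega)
      rcases hn m with h | h
      · rw [h, isAncestor_pred_iff]
        · exact ih
        · rw [h, hor_pred] at h2
          simp only [hor_vertex]; omega
      · rw [← isAncestor_pred_iff, h]
        · exact ih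
        · rw [← h, hor_pred] at h1
          simp only [hor_vertex]; omega
  choose u hu hu' using key
  have hanti : ∀ i j : ℤ, i ≤ j → (u j).ball ⊆ (u i).ball := by
    intro i j hij x hx
    obtain ⟨m, hm1, hm2⟩ := ((hu' i).and (hu' j)).exists
    rw [mem_ball_iff_isAncestor (m := j) (by rw [hu]; exact hij)]
    have h1 : 𝒢.vertex j x = u j := by
      rw [mem_ball_iff, hu] at hx
      exact hx
    rw [h1]
    obtain ⟨a, ha⟩ := exists_eq_vertex (u i)
    obtain ⟨b, hb⟩ := exists_eq_vertex (u j)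
    obtain ⟨c, hc⟩ := exists_eq_vertex (z m)
    rw [hu] at ha hb
    rw [ha, hc, isAncestor_vertex_iff] at hm1
    rw [hb, hc, isAncestor_vertex_iff] at hm2
    rw [ha, hb, isAncestor_vertex_iff]
    refine ⟨hij, ?_⟩
    simpa using sub_mem hm1.2 (sub_anti hij hm2.2)
  obtain ⟨x, hx⟩ := IsCompact.nonempty_iInter_of_directed_nonempty_isCompact_isClosed
    (fun k => (u k).ball)
    (Antitone.directed_ge fun i j hij => hanti i j hij)
    (fun k => by
      obtain ⟨a, ha⟩ := exists_eq_vertex (u k)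
      exact ⟨a, ha.symm⟩)
    (fun _ => isCompact_ball _) (fun _ => isClosed_ball _)
  refine ⟨x, fun k => ?_⟩
  have h1 := mem_ball_iff.1 (Set.mem_iInter.1 hx k)
  rw [hu] at h1
  rw [h1]
  exact hu' k

end Topological

end Geometry

/-! ### Vertex weights, transition probabilities and the transition operator -/

section Weights

open scoped ENNReal

variable {G : Type*} [AddCommGroup G] [TopologicalSpace G] {𝒢 : BallFiltration G}
  [IsTopologicalAddGroup G] [MeasurableSpace G] [BorelSpace G] {F : Measure G}

lemma measurableSet_sub (k : ℤ) : MeasurableSet (𝒢.sub k : Set G) := (𝒢.isOpen k).measurableSet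

lemma measurableSet_ball (u : 𝒢.Vertex) : MeasurableSet u.ball := (isOpen_ball u).measurableSet

section

variable (hfin : ∀ k : ℤ, F ((𝒢.sub k : Set G)ᶜ) < ⊤)
include hfin

lemma a_mono : Monotone (𝒢.a F) := fun _ j hij =>
  measureReal_mono (Set.compl_subset_compl.2 (sub_anti hij)) (hfin j).ne

/-- `F` may be infinite on balls around 0, but a shell avoids the subgroup of index `u.branch + 1`.
-/
lemma measure_shell_ne_top (u : 𝒢.Vertex) : F (shell u) ≠ ⊤ := by
  refine ((measure_mono ?_).trans_lt (hfin (u.branch + 1))).ne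
  by_cases h : u = 𝒢.o u.hor
  · rw [h, shell_o, branch_o]
    exact fun x hx => hx.2
  · rw [shell_of_ne h]
    exact fun x hx => (ball_subset_of_branch_eq h hx).2

end

/-- The shell merges both cases of the definition, and makes the weight additive over the children.
-/
lemma weight_eq (u : 𝒢.Vertex) : 𝒢.weight F u = F.real (shell u) := by
  rw [weight]
  split_ifs with h
  · conv_rhs => rw [h, shell_o]
  · rw [shell_of_ne h]

lemma weight_nonneg (u : 𝒢.Vertex) : 0 ≤ 𝒢.weight F u := by
  rw [weight_eq]
  exact measureReal_nonneg

lemma weight_of_ne {u : 𝒢.Vertex} (h : u ≠ 𝒢.o u.hor) : 𝒢.weight F u = F.real u.ball := by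
  rw [weight, if_neg h]

section

variable (hfin : ∀ k : ℤ, F ((𝒢.sub k : Set G)ᶜ) < ⊤)
include hfin

lemma weight_o (k : ℤ) : 𝒢.weight F (𝒢.o k) = 𝒢.a F (k + 1) - 𝒢.a F k := by
  -- The measure of a difference is subtracted between complements, since only these are known to
  -- have finite measure.
  have h : (𝒢.sub k : Set G) \ 𝒢.sub (k + 1) = (𝒢.sub (k + 1) : Set G)ᶜ \ (𝒢.sub k : Set G)ᶜ := by
    ext x
    simp [and_comm]
  have hle : 𝒢.sub (k + 1) ≤ 𝒢.sub k := sub_anti (by omega)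
  rw [weight_eq, shell_o, h, measureReal_sdiff (Set.compl_subset_compl.2 hle)
    (measurableSet_sub k).compl (hfin (k + 1)).ne]
  rfl

lemma weight_eq_sum_children (u : 𝒢.Vertex) :
    𝒢.weight F u = ∑ v ∈ (finite_children u).toFinset, 𝒢.weight F v := by
  have h : shell u = ⋃ v ∈ (finite_children u).toFinset, v.ball := by
    simp [shell_eq_iUnion]
  have hsub : ∀ v ∈ children u, v.ball ⊆ shell u := fun v hv => by
    rw [shell_eq_iUnion]
    exact Set.subset_biUnion_of_mem hv
  rw [weight_eq, h, measureReal_biUnion_finset (h := fun v hv => ?_)]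
  · exact Finset.sum_congr rfl fun v hv =>
      (weight_of_ne ((finite_children u).mem_toFinset.1 hv).2).symm
  · simpa using pairwiseDisjoint_ball_children u
  · exact fun v _ => measurableSet_ball v
  · exact ((measure_mono (hsub v ((finite_children u).mem_toFinset.1 hv))).trans_lt
      (measure_shell_ne_top hfin u).lt_top).ne

lemma weight_le_of_mem_children {u v : 𝒢.Vertex} (h : v ∈ children u) :
    𝒢.weight F v ≤ 𝒢.weight F u := by
  rw [weight_eq_sum_children hfin u]
  exact Finset.single_le_sum (f := 𝒢.weight F) (fun w _ => weight_nonneg w)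
    ((finite_children u).mem_toFinset.2 h)

lemma tendsto_a_atBot : Tendsto (𝒢.a F) atBot (𝓝 0) := by
  have h := tendsto_measure_iInter_atBot (μ := F) (s := fun k : ℤ => (𝒢.sub k : Set G)ᶜ)
    (fun k => (measurableSet_sub k).compl.nullMeasurableSet)
    (fun i j hij => Set.compl_subset_compl.2 (sub_anti hij)) ⟨0, (hfin 0).ne⟩
  rw [← Set.compl_iUnion, 𝒢.iUnion_eq, Set.compl_univ, measure_empty] at h
  exact (ENNReal.tendsto_toReal ENNReal.zero_ne_top).comp h

end

section

variable (hfin : ∀ k : ℤ, F ((𝒢.sub k : Set G)ᶜ) < ⊤) (hpos : ∀ k : ℤ, 0 < 𝒢.a F k)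

include hpos in
lemma ratio_pos (k : ℤ) : 0 < 𝒢.ratio F k := div_pos (hpos k) (hpos (k + 1))

include hfin hpos in
lemma ratio_le_one (k : ℤ) : 𝒢.ratio F k ≤ 1 :=
  (div_le_one (hpos (k + 1))).2 (a_mono hfin (by omega))

variable (𝒢 F) in
/-- The probability of a step from a vertex of `T_k` to its predecessor. -/
noncomputable def up (k : ℤ) : ℝ := 𝒢.ratio F k / (1 + 𝒢.ratio F k)

variable (𝒢 F) in
/-- The total probability of the steps from a vertex of `T_k` to its successors. -/
noncomputable def down (k : ℤ) : ℝ := 1 / (1 + 𝒢.ratio F k)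

include hpos in
lemma up_pos (k : ℤ) : 0 < 𝒢.up F k := by
  have := ratio_pos hpos k
  unfold up
  positivity

include hpos in
lemma down_pos (k : ℤ) : 0 < 𝒢.down F k := by
  have := ratio_pos hpos k
  unfold down
  positivity

include hpos in
lemma up_add_down (k : ℤ) : 𝒢.up F k + 𝒢.down F k = 1 := by
  have := ratio_pos hpos k
  unfold up down
  field_simp
  ring

lemma p_pred (u : 𝒢.Vertex) : 𝒢.p F u u.pred = 𝒢.up F u.branch := by
  rw [p, if_pos rfl, up]

lemma ne_pred_of_pred_eq {u v : 𝒢.Vertex} (h : v.pred = u) : v ≠ u.pred := by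
  intro h'
  have h1 := hor_of_pred_eq h
  have h2 := congrArg Vertex.hor h'
  rw [hor_pred] at h2
  omega

/-- The two uniform cases, with q - 1 and q, become one: in both the denominator is the number of
children. -/
lemma p_of_mem_children {u v : 𝒢.Vertex} (h : v ∈ children u) : 𝒢.p F u v =
    if 𝒢.weight F u ≠ 0 then 𝒢.weight F v / 𝒢.weight F u * 𝒢.down F u.branch
    else 1 / ((children u).ncard : ℝ) * 𝒢.down F u.branch := by
  have hq : 1 ≤ 𝒢.q u.hor := le_trans one_le_two (𝒢.two_le_relIndex _)
  rw [p, if_neg (ne_pred_of_pred_eq h.1), if_pos (show v.pred = u ∧ v ≠ 𝒢.o v.hor from h), ← down]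
  split_ifs with h1 h2
  · rfl
  · have h3 : (children u).ncard = 𝒢.q u.hor - 1 := by
      conv_lhs => rw [h2, ncard_children_o]
    rw [h3, Nat.cast_sub hq, Nat.cast_one]
  · rw [ncard_children_of_ne h2]

lemma p_eq_zero {u v : 𝒢.Vertex} (h : v ≠ u.pred) (h' : v ∉ children u) : 𝒢.p F u v = 0 := by
  rw [p, if_neg h, if_neg (show ¬ (v.pred = u ∧ v ≠ 𝒢.o v.hor) from h')]

include hfin in
-- In this product form the zero-weight case needs no exception: a child of a vertex of weight 0 has
-- weight 0.
lemma weight_mul_p {u v : 𝒢.Vertex} (h : v ∈ children u) :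
    𝒢.weight F u * 𝒢.p F u v = 𝒢.weight F v * 𝒢.down F u.branch := by
  rw [p_of_mem_children h]
  split_ifs with h1
  · field_simp
  · rw [not_not] at h1
    have h2 : 𝒢.weight F v = 0 :=
      le_antisymm (h1 ▸ weight_le_of_mem_children hfin h) (weight_nonneg v)
    rw [h1, h2, zero_mul, zero_mul]

include hpos in
lemma p_nonneg (u v : 𝒢.Vertex) : 0 ≤ 𝒢.p F u v := by
  by_cases h : v = u.pred
  · rw [h, p_pred]
    exact (up_pos hpos _).le
  · by_cases h' : v ∈ children u
    · have h1 := (down_pos hpos u.branch).le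
      have h2 := weight_nonneg (F := F) u
      have h3 := weight_nonneg (F := F) v
      rw [p_of_mem_children h']
      split_ifs <;> positivity
    · exact (p_eq_zero h h').ge

lemma ncard_children_pos (u : 𝒢.Vertex) : 0 < (children u).ncard := by
  have hq : 2 ≤ 𝒢.q u.hor := 𝒢.two_le_relIndex _
  by_cases h : u = 𝒢.o u.hor
  · have h3 : (children u).ncard = 𝒢.q u.hor - 1 := by
      conv_lhs => rw [h, ncard_children_o]
    omega
  · rw [ncard_children_of_ne h]
    omega

include hfin in
lemma sum_children_p (u : 𝒢.Vertex) :
    ∑ v ∈ (finite_children u).toFinset, 𝒢.p F u v = 𝒢.down F u.branch := by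
  rw [Finset.sum_congr rfl fun v hv => p_of_mem_children ((finite_children u).mem_toFinset.1 hv)]
  split_ifs with h
  · rw [← Finset.sum_mul, ← Finset.sum_div, ← weight_eq_sum_children hfin, div_self h, one_mul]
  · rw [Finset.sum_const, nsmul_eq_mul, ← Set.ncard_eq_toFinset_card _ (finite_children u), ← mul_assoc, mul_one_div,
      div_self (Nat.cast_ne_zero.2 (ncard_children_pos u).ne'), one_mul]

variable (𝒢 F) in
/-- The transition operator of the random walk on nonnegative functions. -/
noncomputable def step (g : 𝒢.Vertex → ℝ≥0∞) (u : 𝒢.Vertex) : ℝ≥0∞ :=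
  ∑' v, ENNReal.ofReal (𝒢.p F u v) * g v

lemma step_eq (g : 𝒢.Vertex → ℝ≥0∞) (u : 𝒢.Vertex) : 𝒢.step F g u =
    ENNReal.ofReal (𝒢.up F u.branch) * g u.pred +
      ∑ v ∈ (finite_children u).toFinset, ENNReal.ofReal (𝒢.p F u v) * g v := by
  classical
  have hnot : u.pred ∉ (finite_children u).toFinset := by
    rw [Set.Finite.mem_toFinset]
    exact fun h => ne_pred_of_pred_eq h.1 rfl
  rw [step, tsum_eq_sum (s := insert u.pred (finite_children u).toFinset), Finset.sum_insert hnot,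
    p_pred]
  intro v hv
  rw [Finset.mem_insert, Set.Finite.mem_toFinset, not_or] at hv
  rw [p_eq_zero hv.1 hv.2, ENNReal.ofReal_zero, zero_mul]

include hfin hpos in
-- Functions of branch and level alone are constant on children, so only the total outward
-- probability matters for them.
lemma step_of_children_eq {g : 𝒢.Vertex → ℝ≥0∞} {u : 𝒢.Vertex} {c : ℝ≥0∞}
    (h : ∀ v ∈ children u, g v = c) : 𝒢.step F g u =
      ENNReal.ofReal (𝒢.up F u.branch) * g u.pred + ENNReal.ofReal (𝒢.down F u.branch) * c := by
  rw [step_eq, Finset.sum_congr rfl fun v hv => by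
    rw [h v ((finite_children u).mem_toFinset.1 hv)], ← Finset.sum_mul,
    ← ENNReal.ofReal_sum_of_nonneg fun v _ => p_nonneg hpos u v, sum_children_p hfin]

include hfin hpos in
lemma tsum_p (u : 𝒢.Vertex) : ∑' v, ENNReal.ofReal (𝒢.p F u v) = 1 := by
  have h := step_of_children_eq hfin hpos (g := fun _ => 1) (u := u) (c := 1) fun _ _ => rfl
  simp only [step, mul_one] at h
  rw [h, ← ENNReal.ofReal_add (up_pos hpos _).le (down_pos hpos _).le, up_add_down hpos,
    ENNReal.ofReal_one]

end

end Weights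

section Chain

open scoped ENNReal

variable {G : Type*} [AddCommGroup G] [TopologicalSpace G] {𝒢 : BallFiltration G}
  [IsTopologicalAddGroup G] [MeasurableSpace G] [BorelSpace G] {F : Measure G}

/-! ### Construction of the walk by the Ionescu-Tulcea theorem -/

section Existence

open ProbabilityTheory

variable (hfin : ∀ k : ℤ, F ((𝒢.sub k : Set G)ᶜ) < ⊤) (hpos : ∀ k : ℤ, 0 < 𝒢.a F k)

/-- The distribution of the position after one step from the vertex `u`. -/
noncomputable def stepPMF (u : 𝒢.Vertex) : PMF 𝒢.Vertex :=
  ⟨fun v => ENNReal.ofReal (𝒢.p F u v), tsum_p hfin hpos u ▸ ENNReal.summable.hasSum⟩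

/-- The transition kernel of the random walk. -/
noncomputable def stepKernel : Kernel 𝒢.Vertex 𝒢.Vertex where
  toFun u := (stepPMF hfin hpos u).toMeasure
  measurable' := measurable_from_top

instance : IsMarkovKernel (stepKernel hfin hpos) :=
  ⟨fun u => inferInstanceAs (IsProbabilityMeasure (stepPMF hfin hpos u).toMeasure)⟩

lemma stepKernel_singleton (u v : 𝒢.Vertex) :
    stepKernel hfin hpos u {v} = ENNReal.ofReal (𝒢.p F u v) :=
  (stepPMF hfin hpos u).toMeasure_apply_singleton v (measurableSet_singleton v)

/-- The transition kernel as a function of the past of the random walk. -/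
noncomputable def pathKernel (m : ℕ) :
    Kernel ((i : Finset.Iic m) → (fun _ : ℕ => 𝒢.Vertex) i) 𝒢.Vertex :=
  (stepKernel hfin hpos).comap (fun x => x ⟨m, Finset.mem_Iic.2 le_rfl⟩) (measurable_pi_apply _)

instance (m : ℕ) : IsMarkovKernel (pathKernel hfin hpos m) := by
  unfold pathKernel
  infer_instance

variable (s : 𝒢.Vertex)

/-- The distribution on the path space of the random walk with starting point `s`. -/
noncomputable def pathMeasure : Measure (ℕ → 𝒢.Vertex) :=
  Kernel.traj (pathKernel hfin hpos) 0 (fun _ => s)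

instance : IsProbabilityMeasure (pathMeasure hfin hpos s) := by
  unfold pathMeasure
  infer_instance

lemma setOf_forall_le_eq_preimage (m : ℕ) (x : ℕ → 𝒢.Vertex) :
    {z : ℕ → 𝒢.Vertex | ∀ i ≤ m, z i = x i} =
      Preorder.frestrictLe (π := fun _ => 𝒢.Vertex) m ⁻¹' {Preorder.frestrictLe (π := fun _ => 𝒢.Vertex) m x} := by
  ext z
  simp [funext_iff]

lemma pathMeasure_succ (m : ℕ) (x : ℕ → 𝒢.Vertex) :
    pathMeasure hfin hpos s {z | ∀ i ≤ m + 1, z i = x i} =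
      pathMeasure hfin hpos s {z | ∀ i ≤ m, z i = x i} *
        ENNReal.ofReal (𝒢.p F (x m) (x (m + 1))) := by
  have h1 : {z : ℕ → 𝒢.Vertex | ∀ i ≤ m + 1, z i = x i} =
      (fun z => (Preorder.frestrictLe (π := fun _ => 𝒢.Vertex) m z, z (m + 1))) ⁻¹'
        ({Preorder.frestrictLe (π := fun _ => 𝒢.Vertex) m x} ×ˢ {x (m + 1)}) := by
    ext z
    simp only [Set.mem_ofPred_eq, Set.mem_preimage, Set.mem_prod, Set.mem_singleton_iff, funext_iff,
      Preorder.frestrictLe_apply, Subtype.forall, Finset.mem_Iic]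
    constructor
    · exact fun h => ⟨fun i hi => h i (by omega), h _ le_rfl⟩
    · rintro ⟨h, h'⟩ i hi
      rcases Nat.le_succ_iff.1 hi with hi | rfl
      exacts [h i hi, h']
  have hm : Measurable (fun z : ℕ → 𝒢.Vertex =>
      (Preorder.frestrictLe (π := fun _ => 𝒢.Vertex) m z, z (m + 1))) := by fun_prop
  rw [h1, setOf_forall_le_eq_preimage, pathMeasure,
    ← Measure.map_apply hm ((measurableSet_singleton _).prod (measurableSet_singleton _)),
    ← Measure.map_apply (by fun_prop) (measurableSet_singleton _),
    Kernel.traj_map_frestrictLe_apply, ← Kernel.partialTraj_compProd_eq_map_traj (Nat.zero_le m),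
    Measure.compProd_apply_prod (measurableSet_singleton _) (measurableSet_singleton _),
    lintegral_singleton, mul_comm]
  congr 1
  rw [pathKernel, Kernel.comap_apply, stepKernel_singleton]
  rfl

open Classical in
lemma pathMeasure_zero (x : ℕ → 𝒢.Vertex) :
    pathMeasure hfin hpos s {z | ∀ i ≤ 0, z i = x i} = if x 0 = s then 1 else 0 := by
  rw [setOf_forall_le_eq_preimage, pathMeasure,
    ← Measure.map_apply (by fun_prop) (measurableSet_singleton _),
    Kernel.traj_map_frestrictLe_apply, Kernel.partialTraj_self, Kernel.id_apply,
    Measure.dirac_apply' _ (measurableSet_singleton _), Set.indicator_apply]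
  refine if_congr ?_ rfl rfl
  rw [Set.mem_singleton_iff, funext_iff]
  constructor
  · exact fun h => (h ⟨0, by simp⟩).symm
  · rintro h ⟨i, hi⟩
    obtain rfl : i = 0 := by simpa using hi
    exact h.symm

lemma isWalk_pathMeasure :
    𝒢.IsWalk F s (pathMeasure hfin hpos s) (fun m z => z m) where
  isProbabilityMeasure := inferInstance
  measurable m := measurable_pi_apply m
  prob_path m x := by
    classical
    induction m with
    | zero =>
      rw [measureReal_def, pathMeasure_zero]
      simp [apply_ite]
    | succ m ih =>
      rw [measureReal_def, pathMeasure_succ, ENNReal.toReal_mul, ← measureReal_def, ih,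
        ENNReal.toReal_ofReal (p_nonneg hpos _ _), Finset.prod_range_succ, ite_mul, zero_mul]

end Existence

/-! ### One-step formulas for an arbitrary realisation of the walk -/

section OneStep

variable {s : 𝒢.Vertex} {Ω : Type*} [MeasurableSpace Ω] {ℙ : Measure Ω} {Z : ℕ → Ω → 𝒢.Vertex}

lemma IsWalk.measure_path_succ (hZ : 𝒢.IsWalk F s ℙ Z) (m : ℕ) (x : ℕ → 𝒢.Vertex) :
    ℙ {ω | ∀ i ≤ m + 1, Z i ω = x i} =
      ℙ {ω | ∀ i ≤ m, Z i ω = x i} * ENNReal.ofReal (𝒢.p F (x m) (x (m + 1))) := by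
  have := hZ.isProbabilityMeasure
  rw [← ofReal_measureReal, ← ofReal_measureReal, ← ENNReal.ofReal_mul measureReal_nonneg,
    hZ.prob_path, hZ.prob_path, Finset.prod_range_succ, ite_mul, zero_mul]

lemma IsWalk.ae_zero_eq (hZ : 𝒢.IsWalk F s ℙ Z) : ∀ᵐ ω ∂ℙ, Z 0 ω = s := by
  have := hZ.isProbabilityMeasure
  have h := hZ.prob_path 0 (fun _ => s)
  simp only [Nat.le_zero, forall_eq, if_true, Finset.range_zero, Finset.prod_empty] at h
  have hm : MeasurableSet {ω | Z 0 ω = s} := hZ.measurable 0 (measurableSet_singleton s)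
  have h' : ℙ {ω | Z 0 ω = s} = 1 := by
    rw [← ofReal_measureReal, h, ENNReal.ofReal_one]
  exact (prob_compl_eq_zero_iff hm).2 h'

/-- The Markov property in integrated form. The path up to time m takes countably many values, so
both integrals are sums over paths and `prob_path` compares them term by term. -/
lemma IsWalk.lintegral_succ_pair (hZ : 𝒢.IsWalk F s ℙ Z) (m : ℕ)
    (g : 𝒢.Vertex → 𝒢.Vertex → ℝ≥0∞) :
    ∫⁻ ω, g (Z m ω) (Z (m + 1) ω) ∂ℙ =
      ∫⁻ ω, ∑' v, ENNReal.ofReal (𝒢.p F (Z m ω) v) * g (Z m ω) v ∂ℙ := by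
  let W : Ω → (Fin (m + 1) → 𝒢.Vertex) := fun ω i => Z i ω
  have hW : Measurable W := measurable_pi_lambda _ fun i => hZ.measurable i
  have hWZ : Measurable fun ω => (W ω, Z (m + 1) ω) := hW.prodMk (hZ.measurable _)
  have h1 : ∀ x v, ℙ ((fun ω => (W ω, Z (m + 1) ω)) ⁻¹' {(x, v)}) =
      ℙ (W ⁻¹' {x}) * ENNReal.ofReal (𝒢.p F (x (Fin.last m)) v) := by
    intro x v
    -- The finite path x, continued by v from time m + 1 on.
    let y : ℕ → 𝒢.Vertex := fun i => if h : i < m + 1 then x ⟨i, h⟩ else v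
    have hy : ∀ i (h : i < m + 1), y i = x ⟨i, h⟩ := fun i h => dif_pos h
    have hy' : y (m + 1) = v := dif_neg (lt_irrefl _)
    have h2 := hZ.measure_path_succ m y
    rw [hy', hy m (by omega)] at h2
    change _ = _ * ENNReal.ofReal (𝒢.p F (x (Fin.last m)) v) at h2
    convert h2 using 2
    · ext ω
      simp only [Set.mem_preimage, Set.mem_singleton_iff, Prod.mk.injEq, funext_iff, W,
        Set.mem_ofPred_eq]
      constructor
      · rintro ⟨h3, h4⟩ i hi
        rcases Nat.le_succ_iff.1 hi with hi | rfl
        · rw [hy i (by omega)]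
          exact h3 ⟨i, by omega⟩
        · rw [hy', h4]
      · intro h3
        exact ⟨fun i => by rw [h3 i (by omega), hy i i.2], by rw [h3 _ le_rfl, hy']⟩
    · congr 1
      ext ω
      simp only [Set.mem_preimage, Set.mem_singleton_iff, funext_iff, W, Set.mem_ofPred_eq]
      exact ⟨fun h3 i hi => by rw [hy i (by omega)]; exact h3 ⟨i, by omega⟩,
        fun h3 i => by rw [h3 i (by omega), hy i i.2]⟩
  have h2 : ∫⁻ ω, g (Z m ω) (Z (m + 1) ω) ∂ℙ =
      ∫⁻ q, g (q.1 (Fin.last m)) q.2 ∂(ℙ.map fun ω => (W ω, Z (m + 1) ω)) := by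
    rw [lintegral_map (measurable_of_countable _) hWZ]
    rfl
  have h3 : ∫⁻ ω, ∑' v, ENNReal.ofReal (𝒢.p F (Z m ω) v) * g (Z m ω) v ∂ℙ =
      ∫⁻ x, ∑' v, ENNReal.ofReal (𝒢.p F (x (Fin.last m)) v) * g (x (Fin.last m)) v ∂(ℙ.map W) := by
    rw [lintegral_map (measurable_of_countable _) hW]
    rfl
  rw [h2, h3, lintegral_countable', lintegral_countable', ENNReal.tsum_prod']
  refine tsum_congr fun x => ?_
  rw [← ENNReal.tsum_mul_right]
  refine tsum_congr fun v => ?_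
  rw [Measure.map_apply hWZ (measurableSet_singleton _), h1,
    Measure.map_apply hW (measurableSet_singleton _)]
  ring

lemma IsWalk.lintegral_succ (hZ : 𝒢.IsWalk F s ℙ Z) (m : ℕ) (g : 𝒢.Vertex → ℝ≥0∞) :
    ∫⁻ ω, g (Z (m + 1) ω) ∂ℙ = ∫⁻ ω, 𝒢.step F g (Z m ω) ∂ℙ :=
  hZ.lintegral_succ_pair m fun _ => g

lemma IsWalk.measurable_comp (hZ : 𝒢.IsWalk F s ℙ Z) {E : Type*} [MeasurableSpace E]
    (g : 𝒢.Vertex → E) (m : ℕ) : Measurable fun ω => g (Z m ω) :=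
  measurable_from_top.comp (hZ.measurable m)

lemma IsWalk.measurableSet (hZ : 𝒢.IsWalk F s ℙ Z) (A : Set 𝒢.Vertex) (m : ℕ) :
    MeasurableSet {ω | Z m ω ∈ A} := hZ.measurable m trivial

lemma IsWalk.lintegral_indicator_one (hZ : 𝒢.IsWalk F s ℙ Z) (A : Set 𝒢.Vertex) (m : ℕ) :
    ∫⁻ ω, A.indicator 1 (Z m ω) ∂ℙ = ℙ {ω | Z m ω ∈ A} := by
  rw [← MeasureTheory.lintegral_indicator_one (hZ.measurableSet A m)]
  rfl

lemma IsWalk.ae_p_ne_zero (hZ : 𝒢.IsWalk F s ℙ Z) :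
    ∀ᵐ ω ∂ℙ, ∀ m, 𝒢.p F (Z m ω) (Z (m + 1) ω) ≠ 0 := by
  rw [ae_all_iff]
  intro m
  classical
  have h := hZ.lintegral_succ_pair m fun u v => if 𝒢.p F u v = 0 then 1 else 0
  have h0 : ∀ u : 𝒢.Vertex, ∑' v, ENNReal.ofReal (𝒢.p F u v) *
      (if 𝒢.p F u v = 0 then 1 else 0) = 0 := by
    intro u
    rw [ENNReal.tsum_eq_zero]
    intro v
    split_ifs with hv <;> simp [hv]
  simp only [h0, lintegral_zero] at h
  have hm : Measurable fun ω => if 𝒢.p F (Z m ω) (Z (m + 1) ω) = 0 then (1 : ℝ≥0∞) else 0 :=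
    (measurable_of_countable fun q : 𝒢.Vertex × 𝒢.Vertex =>
      if 𝒢.p F q.1 q.2 = 0 then (1 : ℝ≥0∞) else 0).comp
        ((hZ.measurable m).prodMk (hZ.measurable (m + 1)))
  rw [lintegral_eq_zero_iff hm] at h
  filter_upwards [h] with ω hω h'
  simp [h'] at hω

lemma IsWalk.ae_step (hZ : 𝒢.IsWalk F s ℙ Z) :
    ∀ᵐ ω ∂ℙ, ∀ m, Z (m + 1) ω = (Z m ω).pred ∨ Z (m + 1) ω ∈ children (Z m ω) := by
  filter_upwards [hZ.ae_p_ne_zero] with ω hω m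
  by_contra! h
  exact hω m (p_eq_zero h.1 h.2)

end OneStep

end Chain

/-! ### Transience and the harmonic function of the ruin problem -/

section Transience

open scoped ENNReal

variable {G : Type*} [AddCommGroup G] [TopologicalSpace G] {𝒢 : BallFiltration G}
  [IsTopologicalAddGroup G] [MeasurableSpace G] [BorelSpace G] {F : Measure G}
  {s : 𝒢.Vertex} {Ω : Type*} [MeasurableSpace Ω] {ℙ : Measure Ω} {Z : ℕ → Ω → 𝒢.Vertex}

lemma branch_pred_le (u : 𝒢.Vertex) : u.pred.branch ≤ u.branch := by
  by_cases h : u = 𝒢.o u.hor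
  · rw [branch_pred_of_eq (branch_eq_hor_iff.2 h)]
    omega
  · rw [branch_pred h]

/-- If `g` is superharmonic and bounded, and decreases by at least `c` on `A`, then the expected
number of visits of `A` is finite. -/
lemma IsWalk.tsum_measure_ne_top_of_step_add_le (hZ : 𝒢.IsWalk F s ℙ Z) {A : Set 𝒢.Vertex}
    {c : ℝ≥0∞} (hc : c ≠ 0) {g : 𝒢.Vertex → ℝ≥0∞} (hg1 : ∀ u, g u ≤ 1)
    (hg : ∀ u, 𝒢.step F g u + c * A.indicator 1 u ≤ g u) :
    ∑' m, ℙ {ω | Z m ω ∈ A} ≠ ⊤ := by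
  have := hZ.isProbabilityMeasure
  have h1 : ∀ M, ∑ m ∈ Finset.range M, c * ℙ {ω | Z m ω ∈ A} + ∫⁻ ω, g (Z M ω) ∂ℙ ≤ 1 := by
    intro M
    induction M with
    | zero =>
      rw [Finset.sum_range_zero, zero_add]
      exact (lintegral_mono fun ω => hg1 _).trans (by simp)
    | succ M ih =>
      refine le_trans ?_ ih
      rw [Finset.sum_range_succ, add_assoc]
      gcongr
      rw [hZ.lintegral_succ, ← hZ.lintegral_indicator_one,
        ← lintegral_const_mul _ (hZ.measurable_comp _ M),
        ← lintegral_add_left (hZ.measurable_comp _ M |>.const_mul c)]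
      refine lintegral_mono fun ω => ?_
      rw [add_comm]
      exact hg _
  have h2 : c * ∑' m, ℙ {ω | Z m ω ∈ A} ≤ 1 := by
    rw [← ENNReal.tsum_mul_left, ENNReal.tsum_eq_iSup_nat]
    exact iSup_le fun M => le_self_add.trans (h1 M)
  intro h
  rw [h, ENNReal.mul_top hc] at h2
  exact absurd h2 (by simp)

/-- If the one-step probabilities from `B` to `A` are bounded below by `c > 0`, and the expected
number of visits of `A` is finite, then so is the expected number of visits of `B`. -/
lemma IsWalk.tsum_measure_ne_top_of_le_step (hZ : 𝒢.IsWalk F s ℙ Z) {A B : Set 𝒢.Vertex}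
    {c : ℝ≥0∞} (hc : c ≠ 0) (hAB : ∀ u ∈ B, c ≤ 𝒢.step F (A.indicator 1) u)
    (hA : ∑' m, ℙ {ω | Z m ω ∈ A} ≠ ⊤) : ∑' m, ℙ {ω | Z m ω ∈ B} ≠ ⊤ := by
  have h1 : ∀ m, c * ℙ {ω | Z m ω ∈ B} ≤ ℙ {ω | Z (m + 1) ω ∈ A} := by
    intro m
    rw [← hZ.lintegral_indicator_one, ← hZ.lintegral_indicator_one, hZ.lintegral_succ,
      ← lintegral_const_mul _ (hZ.measurable_comp _ m)]
    refine lintegral_mono fun ω => ?_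
    by_cases h : Z m ω ∈ B
    · simpa [h] using hAB _ h
    · simp [h]
  have h2 : c * ∑' m, ℙ {ω | Z m ω ∈ B} ≤ ∑' m, ℙ {ω | Z m ω ∈ A} := by
    rw [← ENNReal.tsum_mul_left]
    exact (ENNReal.tsum_le_tsum h1).trans
      (ENNReal.tsum_comp_le_tsum_of_injective (add_left_injective 1) _)
  intro h
  rw [h, ENNReal.mul_top hc, top_le_iff] at h2
  exact hA h2

section

variable (hfin : ∀ k : ℤ, F ((𝒢.sub k : Set G)ᶜ) < ⊤) (hpos : ∀ k : ℤ, 0 < 𝒢.a F k)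
include hfin hpos

lemma ofReal_up_mul_add_ofReal_down_mul (k : ℤ) (c : ℝ≥0∞) :
    ENNReal.ofReal (𝒢.up F k) * c + ENNReal.ofReal (𝒢.down F k) * c = c := by
  rw [← add_mul, ← ENNReal.ofReal_add (up_pos hpos _).le (down_pos hpos _).le, up_add_down hpos,
    ENNReal.ofReal_one, one_mul]

/-- The indicator of j ≤ `branch` is superharmonic because the branch never increases. At `o j` it
drops by the probability of the step to the predecessor, which leaves this set. -/
lemma IsWalk.tsum_measure_o_ne_top (hZ : 𝒢.IsWalk F s ℙ Z) (j : ℤ) :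
    ∑' m, ℙ {ω | Z m ω ∈ ({𝒢.o j} : Set 𝒢.Vertex)} ≠ ⊤ := by
  classical
  refine hZ.tsum_measure_ne_top_of_step_add_le (c := ENNReal.ofReal (𝒢.up F j))
    (g := {u : 𝒢.Vertex | j ≤ u.branch}.indicator 1)
    (ENNReal.ofReal_pos.2 (up_pos hpos j)).ne' (fun u => Set.indicator_le_self' (by simp) u)
    fun u => ?_
  rw [step_of_children_eq hfin hpos (c := {u : 𝒢.Vertex | j ≤ u.branch}.indicator 1 u)
    (fun v hv => by simp only [Set.indicator_apply, Set.mem_ofPred_eq, branch_of_mem_children hv,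
      Pi.one_apply])]
  simp only [Set.indicator_apply, Set.mem_ofPred_eq, Set.mem_singleton_iff, Pi.one_apply]
  by_cases hu : u = 𝒢.o j
  · subst hu
    have h := ofReal_up_mul_add_ofReal_down_mul hfin hpos j 1
    simp [add_comm] at h ⊢
    exact h.le
  · rw [if_neg hu, mul_zero, add_zero]
    calc _ ≤ ENNReal.ofReal (𝒢.up F u.branch) * (if j ≤ u.branch then 1 else 0) +
          ENNReal.ofReal (𝒢.down F u.branch) * (if j ≤ u.branch then 1 else 0) := by
          gcongr
          have := branch_pred_le u
          split_ifs <;> first | omega | simp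
      _ = _ := ofReal_up_mul_add_ofReal_down_mul hfin hpos _ _

/-- Each visit at distance d + 1 from `o j` leads to distance d with the fixed positive probability
`up j`, so finiteness propagates outwards from `o j`. The case f_j = 1 needs no separate treatment.
-/
lemma IsWalk.tsum_measure_level_ne_top (hZ : 𝒢.IsWalk F s ℙ Z) (j : ℤ) (d : ℕ) :
    ∑' m, ℙ {ω | Z m ω ∈ {u : 𝒢.Vertex | u.branch = j ∧ u.hor = j + d}} ≠ ⊤ := by
  induction d with
  | zero =>
    have hset : {u : 𝒢.Vertex | u.branch = j ∧ u.hor = j + (0 : ℕ)} = {𝒢.o j} := by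
      ext u
      simp only [Set.mem_ofPred_eq, Set.mem_singleton_iff, Nat.cast_zero, add_zero]
      constructor
      · rintro ⟨h1, h2⟩
        have := branch_eq_hor_iff.1 (h1.trans h2.symm)
        rwa [h2] at this
      · rintro rfl
        simp
    rw [hset]
    exact hZ.tsum_measure_o_ne_top hfin hpos j
  | succ d ih =>
    refine hZ.tsum_measure_ne_top_of_le_step (c := ENNReal.ofReal (𝒢.up F j))
      (ENNReal.ofReal_pos.2 (up_pos hpos j)).ne' (fun u hu => ?_) ih
    obtain ⟨h1, h2⟩ := hu
    push_cast at h2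
    have h3 : u ≠ 𝒢.o u.hor := fun h => by
      have := branch_eq_hor_iff.2 h
      omega
    rw [step_eq, h1, Set.indicator_of_mem]
    · simp
    · exact ⟨by rw [branch_pred h3, h1], by rw [hor_pred, h2]; ring⟩

/-- Almost surely, the random walk leaves the part of `T_k` below the level `L` eventually. -/
lemma IsWalk.ae_eventually_le_hor (hZ : 𝒢.IsWalk F s ℙ Z) :
    ∀ᵐ ω ∂ℙ, ∀ k L : ℤ, ∀ᶠ m in atTop, (Z m ω).branch = k → L ≤ (Z m ω).hor := by
  have h1 : ∀ᵐ ω ∂ℙ, ∀ (k : ℤ) (d : ℕ), ∀ᶠ m in atTop,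
      ¬ ((Z m ω).branch = k ∧ (Z m ω).hor = k + d) := by
    rw [ae_all_iff]
    intro k
    rw [ae_all_iff]
    intro d
    exact ae_eventually_notMem (hZ.tsum_measure_level_ne_top hfin hpos k d)
  filter_upwards [h1] with ω hω k L
  have h2 : ∀ᶠ m in atTop, ∀ d ∈ Finset.range (L - k).toNat,
      ¬ ((Z m ω).branch = k ∧ (Z m ω).hor = k + d) :=
    (Filter.eventually_all_finset _).2 fun d _ => hω k d
  filter_upwards [h2] with m hm hk
  by_contra! h
  have h3 := branch_le_hor (Z m ω)
  exact hm ((Z m ω).hor - k).toNat (by simp; omega) ⟨hk, by omega⟩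

end

lemma IsWalk.ae_branch_antitone (hZ : 𝒢.IsWalk F s ℙ Z) :
    ∀ᵐ ω ∂ℙ, Antitone fun m => (Z m ω).branch := by
  filter_upwards [hZ.ae_step] with ω hω
  refine antitone_nat_of_succ_le fun m => ?_
  rcases hω m with h | h
  · rw [h]
    exact branch_pred_le _
  · rw [branch_of_mem_children h]

lemma IsWalk.ae_branch_le (hZ : 𝒢.IsWalk F s ℙ Z) :
    ∀ᵐ ω ∂ℙ, ∀ m, (Z m ω).branch ≤ s.branch := by
  filter_upwards [hZ.ae_branch_antitone, hZ.ae_zero_eq] with ω h1 h2 m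
  rw [← h2]
  exact h1 (Nat.zero_le m)

/-- The sum `1 + f_k + ... + f_k ^ d` at the vertices of `T_k` with distance `d` from `o_k`, extended
by the constants `1` on `T_j` for `k < j` and `0` on `T_j` for `j < k`. -/
noncomputable def geomFun (F : Measure G) (k : ℤ) (u : 𝒢.Vertex) : ℝ≥0∞ :=
  if u.branch = k then
    ENNReal.ofReal (∑ i ∈ Finset.range ((u.hor - k).toNat + 1), 𝒢.ratio F k ^ i)
  else if k < u.branch then 1 else 0

lemma geomFun_o (j k : ℤ) : geomFun F k (𝒢.o j) = if k ≤ j then 1 else 0 := by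
  rw [geomFun, branch_o, hor_o]
  by_cases h : j = k
  · subst h
    simp
  · rw [if_neg h]
    exact if_congr ⟨fun h' => h'.le, fun h' => lt_of_le_of_ne h' (Ne.symm h)⟩ rfl rfl

section

variable (hfin : ∀ k : ℤ, F ((𝒢.sub k : Set G)ᶜ) < ⊤) (hpos : ∀ k : ℤ, 0 < 𝒢.a F k)
include hfin hpos

/-- With S_d the sum of the first d powers, this follows from S_{d+1} = 1 + f S_d, applied twice. -/
lemma up_mul_geom_add_down_mul_geom (k : ℤ) (d : ℕ) :
    𝒢.up F k * ∑ i ∈ Finset.range d, 𝒢.ratio F k ^ i +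
      𝒢.down F k * ∑ i ∈ Finset.range (d + 2), 𝒢.ratio F k ^ i =
    ∑ i ∈ Finset.range (d + 1), 𝒢.ratio F k ^ i := by
  have h0 := ratio_pos hpos k
  have h1 : ∑ i ∈ Finset.range (d + 1), 𝒢.ratio F k ^ i =
      𝒢.ratio F k * ∑ i ∈ Finset.range d, 𝒢.ratio F k ^ i + 1 := by
    rw [Finset.sum_range_succ', Finset.mul_sum]
    simp only [pow_succ', pow_zero]
  have h2 : ∑ i ∈ Finset.range (d + 2), 𝒢.ratio F k ^ i =
      𝒢.ratio F k * ∑ i ∈ Finset.range (d + 1), 𝒢.ratio F k ^ i + 1 := by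
    rw [Finset.sum_range_succ', Finset.mul_sum]
    simp only [pow_succ', pow_zero]
  rw [h2, h1, up, down]
  field_simp
  ring

/-- The three pieces fit at the transitions: the predecessor of `o k` has the value 0 of an empty
sum, and `o k` has the value 1 of the vertices of T_{k+1}. -/
lemma step_geomFun (k : ℤ) (u : 𝒢.Vertex) : 𝒢.step F (geomFun F k) u = geomFun F k u := by
  have hr := (ratio_pos hpos k).le
  rcases lt_trichotomy u.branch k with h | h | h
  · rw [step_of_children_eq hfin hpos (c := 0)]
    · have := branch_pred_le u
      rw [geomFun, geomFun, if_neg (by omega), if_neg (by omega), if_neg (by omega),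
        if_neg (by omega)]
      simp
    · intro v hv
      rw [geomFun, branch_of_mem_children hv, if_neg (by omega), if_neg (by omega)]
  · have hle := branch_le_hor u
    rw [step_of_children_eq hfin hpos (c := ENNReal.ofReal
      (∑ i ∈ Finset.range ((u.hor - k).toNat + 2), 𝒢.ratio F k ^ i))]
    · have hgu : geomFun F k u = ENNReal.ofReal
          (∑ i ∈ Finset.range ((u.hor - k).toNat + 1), 𝒢.ratio F k ^ i) := if_pos h
      have hgp : geomFun F k u.pred = ENNReal.ofReal
          (∑ i ∈ Finset.range (u.hor - k).toNat, 𝒢.ratio F k ^ i) := by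
        by_cases hu : u = 𝒢.o u.hor
        · have h1 := branch_eq_hor_iff.2 hu
          have h2 := branch_pred_of_eq h1
          rw [geomFun, if_neg (by omega), if_neg (by omega), show (u.hor - k).toNat = 0 by omega]
          simp
        · have h1 := mt branch_eq_hor_iff.1 hu
          rw [geomFun, branch_pred hu, if_pos h, hor_pred]
          congr 3
          omega
      rw [hgu, hgp, h, ← ENNReal.ofReal_mul (up_pos hpos k).le,
        ← ENNReal.ofReal_mul (down_pos hpos k).le, ← ENNReal.ofReal_add,
        up_mul_geom_add_down_mul_geom hfin hpos]
      · exact mul_nonneg (up_pos hpos k).le (Finset.sum_nonneg fun i _ => pow_nonneg hr i)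
      · exact mul_nonneg (down_pos hpos k).le (Finset.sum_nonneg fun i _ => pow_nonneg hr i)
    · intro v hv
      rw [geomFun, branch_of_mem_children hv, if_pos h, hor_of_mem_children hv]
      congr 3
      omega
  · have hgu : geomFun F k u = 1 := by rw [geomFun, if_neg (by omega), if_pos h]
    rw [step_of_children_eq hfin hpos (c := 1)]
    · have hgp : geomFun F k u.pred = 1 := by
        by_cases hu : u = 𝒢.o u.hor
        · have h1 := branch_eq_hor_iff.2 hu
          rw [hu, pred_o, geomFun_o, if_pos (by omega)]
        · rw [geomFun, branch_pred hu, if_neg (by omega), if_pos h]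
      rw [hgu, hgp, ofReal_up_mul_add_ofReal_down_mul hfin hpos]
    · intro v hv
      rw [geomFun, branch_of_mem_children hv, if_neg (by omega), if_pos h]

lemma IsWalk.lintegral_geomFun (hZ : 𝒢.IsWalk F s ℙ Z) (k : ℤ) (m : ℕ) :
    ∫⁻ ω, geomFun F k (Z m ω) ∂ℙ = geomFun F k s := by
  have := hZ.isProbabilityMeasure
  induction m with
  | zero =>
    rw [lintegral_congr_ae (g := fun _ => geomFun F k s)]
    · simp
    · filter_upwards [hZ.ae_zero_eq] with ω hω
      rw [hω]
  | succ m ih =>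
    rw [hZ.lintegral_succ, ← ih]
    simp only [step_geomFun hfin hpos]

end

end Transience

/-! ### The law of the final subtree, and almost sure convergence -/

section BranchDistribution

open scoped ENNReal

variable {G : Type*} [AddCommGroup G] [TopologicalSpace G] {𝒢 : BallFiltration G}
  [IsTopologicalAddGroup G] [MeasurableSpace G] [BorelSpace G] {F : Measure G}
  {s : 𝒢.Vertex} {Ω : Type*} [MeasurableSpace Ω] {ℙ : Measure Ω} {Z : ℕ → Ω → 𝒢.Vertex}

/-- Dominated convergence for indicators; it carries every fixed-time identity to the limit. -/
lemma IsWalk.tendsto_measureReal (hZ : 𝒢.IsWalk F s ℙ Z) {A : Set 𝒢.Vertex} {E : Set Ω}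
    (hE : MeasurableSet E) (h : ∀ᵐ ω ∂ℙ, ∀ᶠ m in atTop, Z m ω ∈ A ↔ ω ∈ E) :
    Tendsto (fun m => ℙ.real {ω | Z m ω ∈ A}) atTop (𝓝 (ℙ.real E)) := by
  have := hZ.isProbabilityMeasure
  exact (ENNReal.tendsto_toReal (measure_ne_top ℙ E)).comp
    (tendsto_measure_of_ae_tendsto_indicator_of_isFiniteMeasure atTop hE
      (hZ.measurableSet A) h)

lemma IsWalk.measurableSet_exists_branch_le (hZ : 𝒢.IsWalk F s ℙ Z) (k : ℤ) :
    MeasurableSet {ω | ∃ m, (Z m ω).branch ≤ k} := by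
  have h : {ω | ∃ m, (Z m ω).branch ≤ k} = ⋃ m, {ω | Z m ω ∈ {u : 𝒢.Vertex | u.branch ≤ k}} := by
    ext ω
    simp
  rw [h]
  exact MeasurableSet.iUnion fun m => hZ.measurableSet _ m

lemma IsWalk.tendsto_measureReal_branch_le (hZ : 𝒢.IsWalk F s ℙ Z) (k : ℤ) :
    Tendsto (fun m => ℙ.real {ω | Z m ω ∈ {u : 𝒢.Vertex | u.branch ≤ k}}) atTop
      (𝓝 (ℙ.real {ω | ∃ m, (Z m ω).branch ≤ k})) := by
  refine hZ.tendsto_measureReal (hZ.measurableSet_exists_branch_le k) ?_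
  filter_upwards [hZ.ae_branch_antitone] with ω hω
  by_cases h : ∃ m, (Z m ω).branch ≤ k
  · obtain ⟨M, hM⟩ := h
    filter_upwards [eventually_ge_atTop M] with m hm
    exact ⟨fun _ => ⟨M, hM⟩, fun _ => (hω hm).trans hM⟩
  · exact Eventually.of_forall fun m => ⟨fun h' => ⟨m, h'⟩, fun h' => absurd h' h⟩

lemma IsWalk.measureReal_branch_eq (hZ : 𝒢.IsWalk F s ℙ Z) (k : ℤ) (m : ℕ) :
    ℙ.real {ω | Z m ω ∈ {u : 𝒢.Vertex | u.branch = k}} =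
      ℙ.real {ω | Z m ω ∈ {u : 𝒢.Vertex | u.branch ≤ k}} -
        ℙ.real {ω | Z m ω ∈ {u : 𝒢.Vertex | u.branch ≤ k - 1}} := by
  have := hZ.isProbabilityMeasure
  rw [← measureReal_sdiff _ (hZ.measurableSet _ m)]
  · congr 1
    ext ω
    simp only [Set.mem_ofPred_eq, Set.mem_sdiff]
    omega
  · intro ω hω
    simp only [Set.mem_ofPred_eq] at hω ⊢
    omega

lemma IsWalk.tendsto_measureReal_branch_eq (hZ : 𝒢.IsWalk F s ℙ Z) (k : ℤ) :
    Tendsto (fun m => ℙ.real {ω | Z m ω ∈ {u : 𝒢.Vertex | u.branch = k}}) atTop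
      (𝓝 (ℙ.real {ω | ∃ m, (Z m ω).branch ≤ k} - ℙ.real {ω | ∃ m, (Z m ω).branch ≤ k - 1})) := by
  simp only [hZ.measureReal_branch_eq]
  exact (hZ.tendsto_measureReal_branch_le k).sub (hZ.tendsto_measureReal_branch_le (k - 1))

lemma IsWalk.measureReal_lt_branch (hZ : 𝒢.IsWalk F s ℙ Z) (k : ℤ) (m : ℕ) :
    ℙ.real {ω | Z m ω ∈ {u : 𝒢.Vertex | k < u.branch}} =
      1 - ℙ.real {ω | Z m ω ∈ {u : 𝒢.Vertex | u.branch ≤ k}} := by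
  have := hZ.isProbabilityMeasure
  rw [← probReal_compl_eq_one_sub (hZ.measurableSet _ m)]
  congr 1
  ext ω
  simp

section

variable (hfin : ∀ k : ℤ, F ((𝒢.sub k : Set G)ᶜ) < ⊤) (hpos : ∀ k : ℤ, 0 < 𝒢.a F k)
include hfin hpos

lemma IsWalk.tendsto_measureReal_hor_lt (hZ : 𝒢.IsWalk F s ℙ Z) (k L : ℤ) :
    Tendsto (fun m => ℙ.real {ω | Z m ω ∈ {u : 𝒢.Vertex | u.branch = k ∧ u.hor < L}}) atTop
      (𝓝 0) := by
  rw [← measureReal_empty (μ := ℙ)]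
  refine hZ.tendsto_measureReal MeasurableSet.empty ?_
  filter_upwards [hZ.ae_eventually_le_hor hfin hpos] with ω hω
  filter_upwards [hω k L] with m hm
  simp only [Set.mem_empty_iff_false, iff_false]
  exact fun h => absurd (hm h.1) (not_le.2 h.2)

/-- The mean of `geomFun` stays 1, and on T_k the geometric sum satisfies (1 - f) S ≤ 1. -/
lemma IsWalk.one_sub_ratio_mul_le (hZ : 𝒢.IsWalk F s ℙ Z) {k : ℤ} (hs : geomFun F k s = 1)
    (m : ℕ) : (1 - 𝒢.ratio F k) * ℙ.real {ω | Z m ω ∈ {u : 𝒢.Vertex | u.branch ≤ k}} ≤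
      ℙ.real {ω | Z m ω ∈ {u : 𝒢.Vertex | u.branch = k}} := by
  have := hZ.isProbabilityMeasure
  have hr := ratio_pos hpos k
  have hr1 := ratio_le_one hfin hpos k
  have hpt : ∀ u : 𝒢.Vertex, ENNReal.ofReal (1 - 𝒢.ratio F k) * geomFun F k u ≤
      {u : 𝒢.Vertex | u.branch = k}.indicator 1 u +
        ENNReal.ofReal (1 - 𝒢.ratio F k) * {u : 𝒢.Vertex | k < u.branch}.indicator 1 u := by
    intro u
    rcases lt_trichotomy u.branch k with h | h | h
    · rw [geomFun, if_neg (by omega), if_neg (by omega), mul_zero]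
      exact zero_le
    · refine le_trans ?_ le_self_add
      rw [geomFun, if_pos h, Set.indicator_of_mem (by exact h), Pi.one_apply,
        ← ENNReal.ofReal_mul (by linarith), ENNReal.ofReal_le_one, mul_neg_geom_sum]
      linarith [pow_nonneg hr.le ((u.hor - k).toNat + 1)]
    · rw [geomFun, if_neg (by omega), if_pos h]
      refine le_trans ?_ le_add_self
      rw [Set.indicator_of_mem (by exact h), Pi.one_apply]
  have h1 := lintegral_mono (μ := ℙ) fun ω => hpt (Z m ω)
  rw [lintegral_const_mul _ (hZ.measurable_comp _ m), hZ.lintegral_geomFun hfin hpos, hs, mul_one,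
    lintegral_add_left (hZ.measurable_comp _ m), lintegral_const_mul _ (hZ.measurable_comp _ m),
    hZ.lintegral_indicator_one, hZ.lintegral_indicator_one, ← ofReal_measureReal,
    ← ofReal_measureReal, ← ENNReal.ofReal_mul (by linarith), ← ENNReal.ofReal_add
      measureReal_nonneg (mul_nonneg (by linarith) measureReal_nonneg),
    ENNReal.ofReal_le_ofReal_iff
      (add_nonneg measureReal_nonneg (mul_nonneg (by linarith) measureReal_nonneg)),
    hZ.measureReal_lt_branch] at h1
  linarith

/-- The converse estimate: at distance at least N from `o k` the function is at least the sum of the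
first N powers, and the vertices closer to `o k` carry no mass in the limit. -/
lemma IsWalk.geom_sum_mul_le (hZ : 𝒢.IsWalk F s ℙ Z) {k : ℤ} (hs : geomFun F k s = 1)
    (N m : ℕ) : (∑ i ∈ Finset.range N, 𝒢.ratio F k ^ i) *
      (ℙ.real {ω | Z m ω ∈ {u : 𝒢.Vertex | u.branch = k}} -
        ℙ.real {ω | Z m ω ∈ {u : 𝒢.Vertex | u.branch = k ∧ u.hor < k + N}}) ≤
      ℙ.real {ω | Z m ω ∈ {u : 𝒢.Vertex | u.branch ≤ k}} := by
  have := hZ.isProbabilityMeasure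
  have hr := (ratio_pos hpos k).le
  have hS : 0 ≤ ∑ i ∈ Finset.range N, 𝒢.ratio F k ^ i :=
    Finset.sum_nonneg fun i _ => pow_nonneg hr i
  have hpt : ∀ u : 𝒢.Vertex, ENNReal.ofReal (∑ i ∈ Finset.range N, 𝒢.ratio F k ^ i) *
      {u : 𝒢.Vertex | u.branch = k ∧ k + N ≤ u.hor}.indicator 1 u +
        {u : 𝒢.Vertex | k < u.branch}.indicator 1 u ≤ geomFun F k u := by
    intro u
    rcases lt_trichotomy u.branch k with h | h | h
    · rw [Set.indicator_of_notMem (fun h' => h.ne h'.1),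
        Set.indicator_of_notMem (s := {u : 𝒢.Vertex | k < u.branch}) (not_lt.2 h.le)]
      simp
    · rw [geomFun, if_pos h, Set.indicator_of_notMem (s := {u : 𝒢.Vertex | k < u.branch})
        (not_lt.2 h.le), add_zero]
      by_cases h' : k + N ≤ u.hor
      · rw [Set.indicator_of_mem (by exact ⟨h, h'⟩), Pi.one_apply, mul_one]
        refine ENNReal.ofReal_le_ofReal (Finset.sum_le_sum_of_subset_of_nonneg ?_
          fun i _ _ => pow_nonneg hr i)
        exact Finset.range_mono (by omega)
      · rw [Set.indicator_of_notMem (fun h'' => h' h''.2), mul_zero]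
        exact zero_le
    · rw [geomFun, if_neg (by omega), if_pos h, Set.indicator_of_notMem (fun h' => h.ne' h'.1),
        Set.indicator_of_mem (by exact h)]
      simp
  have h1 := lintegral_mono (μ := ℙ) fun ω => hpt (Z m ω)
  rw [hZ.lintegral_geomFun hfin hpos, hs, lintegral_add_right _ (hZ.measurable_comp _ m),
    lintegral_const_mul _ (hZ.measurable_comp _ m),
    hZ.lintegral_indicator_one, hZ.lintegral_indicator_one, ← ofReal_measureReal,
    ← ofReal_measureReal, ← ENNReal.ofReal_mul hS, ← ENNReal.ofReal_add
      (mul_nonneg hS measureReal_nonneg) measureReal_nonneg,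
    ENNReal.ofReal_le_one, hZ.measureReal_lt_branch] at h1
  have h2 : ℙ.real {ω | Z m ω ∈ {u : 𝒢.Vertex | u.branch = k}} -
        ℙ.real {ω | Z m ω ∈ {u : 𝒢.Vertex | u.branch = k ∧ u.hor < k + N}} =
        ℙ.real {ω | Z m ω ∈ {u : 𝒢.Vertex | u.branch = k ∧ k + N ≤ u.hor}} := by
    rw [← measureReal_sdiff (fun ω hω => by exact hω.1) (hZ.measurableSet _ m)]
    congr 1
    ext ω
    simp only [Set.mem_ofPred_eq, Set.mem_sdiff]
    omega
  rw [h2]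
  linarith

/-- The probability of reaching `T_{k-1}` from `T_k` is `f_k`. -/
lemma IsWalk.measureReal_exists_branch_le_pred (hZ : 𝒢.IsWalk F s ℙ Z) {k : ℤ}
    (hs : geomFun F k s = 1) : ℙ.real {ω | ∃ m, (Z m ω).branch ≤ k - 1} =
      𝒢.ratio F k * ℙ.real {ω | ∃ m, (Z m ω).branch ≤ k} := by
  have := hZ.isProbabilityMeasure
  have hr := ratio_pos hpos k
  have ht := hZ.tendsto_measureReal_branch_eq k
  have hB := hZ.tendsto_measureReal_branch_le k
  set β := ℙ.real {ω | ∃ m, (Z m ω).branch ≤ k} with hβ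
  set β' := ℙ.real {ω | ∃ m, (Z m ω).branch ≤ k - 1}
  have h1 : (1 - 𝒢.ratio F k) * β ≤ β - β' :=
    le_of_tendsto_of_tendsto' (hB.const_mul _) ht fun m => hZ.one_sub_ratio_mul_le hfin hpos hs m
  have h2 : ∀ N : ℕ, (∑ i ∈ Finset.range N, 𝒢.ratio F k ^ i) * (β - β' - 0) ≤ β := fun N =>
    le_of_tendsto_of_tendsto' ((ht.sub (hZ.tendsto_measureReal_hor_lt hfin hpos k _)).const_mul _)
      hB fun m => hZ.geom_sum_mul_le hfin hpos hs N m
  simp only [sub_zero] at h2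
  -- For f < 1 the sums in `h2` tend to 1/(1 - f) and `h1` becomes an equality. For f = 1 they equal
  -- N and are unbounded, which forces β = β'.
  rcases (ratio_le_one hfin hpos k).lt_or_eq with h | h
  · have h3 : (1 - 𝒢.ratio F k)⁻¹ * (β - β') ≤ β :=
      le_of_tendsto' ((hasSum_geometric_of_lt_one hr.le h).tendsto_sum_nat.mul_const _) h2
    rw [inv_mul_le_iff₀ (by linarith)] at h3
    linarith
  · rw [h] at h1 h2 ⊢
    have h3 : β - β' ≤ 0 := by
      by_contra! h3
      obtain ⟨N, hN⟩ := exists_nat_gt (β / (β - β'))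
      rw [div_lt_iff₀ h3] at hN
      have := h2 N
      simp at this
      linarith
    linarith

end

section

variable (hfin : ∀ k : ℤ, F ((𝒢.sub k : Set G)ᶜ) < ⊤) (hpos : ∀ k : ℤ, 0 < 𝒢.a F k) {n : ℤ}
include hfin hpos

lemma IsWalk.measureReal_exists_branch_le (hZ : 𝒢.IsWalk F (𝒢.o (n - 1)) ℙ Z) {k : ℤ}
    (hk : k ≤ n - 1) : ℙ.real {ω | ∃ m, (Z m ω).branch ≤ k} = 𝒢.a F (k + 1) / 𝒢.a F n := by
  have := hZ.isProbabilityMeasure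
  induction k, hk using Int.leInductionDown with
  | base =>
    rw [sub_add_cancel, div_self (hpos n).ne']
    have h : ∀ᵐ ω ∂ℙ, ω ∈ {ω | ∃ m, (Z m ω).branch ≤ n - 1} := by
      filter_upwards [hZ.ae_branch_le] with ω hω
      exact ⟨0, by simpa using hω 0⟩
    rw [measureReal_def, (mem_ae_iff_prob_eq_one (hZ.measurableSet_exists_branch_le _)).1 h,
      ENNReal.toReal_one]
  | pred k hk ih =>
    rw [hZ.measureReal_exists_branch_le_pred hfin hpos, ih, ratio, sub_add_cancel]
    · have := (hpos (k + 1)).ne'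
      have := (hpos n).ne'
      field_simp
    · rw [geomFun_o, if_pos hk]

lemma IsWalk.tendsto_measureReal_branch (hZ : 𝒢.IsWalk F (𝒢.o (n - 1)) ℙ Z) {k : ℤ}
    (hk : k ≤ n - 1) :
    Tendsto (fun m => ℙ.real {ω | Z m ω ∈ {u : 𝒢.Vertex | u.branch = k}}) atTop
      (𝓝 (𝒢.weight F (𝒢.o k) / 𝒢.a F n)) := by
  have h := hZ.tendsto_measureReal_branch_eq k
  rw [hZ.measureReal_exists_branch_le hfin hpos hk, hZ.measureReal_exists_branch_le hfin hpos
    (by omega : k - 1 ≤ n - 1), sub_add_cancel, ← sub_div, ← weight_o hfin] at h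
  exact h

/-- Reaching every T_k has probability at most a_{k+1}/a_n for each k ≤ n - 1, and this tends to 0
as k → -∞. -/
lemma IsWalk.ae_exists_le_branch (hZ : 𝒢.IsWalk F (𝒢.o (n - 1)) ℙ Z) :
    ∀ᵐ ω ∂ℙ, ∃ k, ∀ m, k < (Z m ω).branch := by
  have := hZ.isProbabilityMeasure
  have h1 : ∀ k ≤ n - 1, ℙ.real {ω | ¬ ∃ k, ∀ m, k < (Z m ω).branch} ≤
      𝒢.a F (k + 1) / 𝒢.a F n := by
    intro k hk
    rw [← hZ.measureReal_exists_branch_le hfin hpos hk]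
    refine measureReal_mono fun ω hω => ?_
    simp only [Set.mem_ofPred_eq, not_exists, not_forall, not_lt] at hω ⊢
    exact hω k
  have h2 : Tendsto (fun k => 𝒢.a F (k + 1) / 𝒢.a F n) atBot (𝓝 0) := by
    have := ((tendsto_a_atBot hfin).comp (tendsto_atBot_add_const_right atBot (1 : ℤ)
      tendsto_id)).div_const (𝒢.a F n)
    simpa using this
  have h3 : ℙ.real {ω | ¬ ∃ k, ∀ m, k < (Z m ω).branch} ≤ 0 :=
    ge_of_tendsto h2 ((eventually_le_atBot (n - 1)).mono h1)
  rw [ae_iff, ← ofReal_measureReal, ENNReal.ofReal_eq_zero]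
  exact h3

lemma IsWalk.ae_tendsto_hor (hZ : 𝒢.IsWalk F (𝒢.o (n - 1)) ℙ Z) :
    ∀ᵐ ω ∂ℙ, Tendsto (fun m => (Z m ω).hor) atTop atTop := by
  filter_upwards [hZ.ae_exists_le_branch hfin hpos, hZ.ae_branch_le,
    hZ.ae_eventually_le_hor hfin hpos] with ω ⟨k, hk⟩ hle hev
  rw [branch_o] at hle
  refine tendsto_atTop.2 fun L => ?_
  -- Only finitely many subtrees are ever visited, so the bounds for the single subtrees hold
  -- simultaneously from some time on.
  have h : ∀ᶠ m in atTop, ∀ j ∈ Finset.Icc k (n - 1), (Z m ω).branch = j → L ≤ (Z m ω).hor :=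
    (Filter.eventually_all_finset _).2 fun j _ => hev j L
  filter_upwards [h] with m hm
  exact hm _ (Finset.mem_Icc.2 ⟨(hk m).le, hle m⟩) rfl

/-- The random walk converges almost surely to a boundary point. -/
lemma IsWalk.ae_exists_convergesTo (hZ : 𝒢.IsWalk F (𝒢.o (n - 1)) ℙ Z) :
    ∀ᵐ ω ∂ℙ, ∃ x, 𝒢.ConvergesTo (fun m => Z m ω) x := by
  filter_upwards [hZ.ae_tendsto_hor hfin hpos, hZ.ae_step] with ω h1 h2
  exact exists_convergesTo h1 fun m => (h2 m).imp id fun h => h.1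

end

/-- Convergence to 0 would bring the walk below `o n`, but its branch never exceeds n - 1. -/
lemma IsWalk.ae_ne_zero {n : ℤ} (hZ : 𝒢.IsWalk F (𝒢.o (n - 1)) ℙ Z) :
    ∀ᵐ ω ∂ℙ, ¬ 𝒢.ConvergesTo (fun m => Z m ω) 0 := by
  filter_upwards [hZ.ae_branch_le] with ω hω h
  obtain ⟨m, hm⟩ := (h n).exists
  have h1 : n ≤ (Z m ω).branch := o_isAncestor_iff.1 hm
  have h2 := hω m
  rw [branch_o] at h2
  omega

lemma IsWalk.measurableSet_eventually_isAncestor (hZ : 𝒢.IsWalk F s ℙ Z) (u : 𝒢.Vertex) :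
    MeasurableSet {ω | ∀ᶠ m in atTop, u.IsAncestor (Z m ω)} := by
  have h : {ω | ∀ᶠ m in atTop, u.IsAncestor (Z m ω)} =
      ⋃ M : ℕ, ⋂ m ≥ M, {ω | Z m ω ∈ {v | u.IsAncestor v}} := by
    ext ω
    simp [eventually_atTop]
  rw [h]
  exact MeasurableSet.iUnion fun M => MeasurableSet.iInter fun m =>
    MeasurableSet.iInter fun _ => hZ.measurableSet _ m

lemma IsWalk.exists_isBoundaryLimit (hZ : 𝒢.IsWalk F s ℙ Z)
    (h : ∀ᵐ ω ∂ℙ, ∃ x, 𝒢.ConvergesTo (fun m => Z m ω) x) : ∃ Y, 𝒢.IsBoundaryLimit ℙ Z Y := by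
  classical
  -- A measurable null set containing the exceptional set. The limit is set to 0 there; elsewhere
  -- the preimage of a ball is a tail event.
  let N := toMeasurable ℙ {ω | ¬ ∃ x, 𝒢.ConvergesTo (fun m => Z m ω) x}
  have hN : ℙ N = 0 := by
    rw [measure_toMeasurable]
    exact ae_iff.1 h
  have hNc : ∀ ω, ω ∉ N → ∃ x, 𝒢.ConvergesTo (fun m => Z m ω) x := by
    intro ω hω
    by_contra h'
    exact hω (subset_toMeasurable ℙ _ h')
  let Y : Ω → G := fun ω => if hω : ω ∈ N then 0 else (hNc ω hω).choose
  have hY : ∀ ω, ω ∉ N → 𝒢.ConvergesTo (fun m => Z m ω) (Y ω) := by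
    intro ω hω
    simp only [Y, dif_neg hω]
    exact (hNc ω hω).choose_spec
  refine ⟨Y, measurable_of_ball (𝒢 := 𝒢) fun u => ?_, ?_⟩
  · have h1 : Y ⁻¹' u.ball = (N ∩ {_ω | (0 : G) ∈ u.ball}) ∪
        (Nᶜ ∩ {ω | ∀ᶠ m in atTop, u.IsAncestor (Z m ω)}) := by
      ext ω
      by_cases hω : ω ∈ N
      · simp [hω, Y]
      · simpa [hω] using convergesTo_iff (hY ω hω) u
    rw [h1]
    have hNm : MeasurableSet N := measurableSet_toMeasurable _ _
    exact (hNm.inter (MeasurableSet.const _)).union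
      (hNm.compl.inter (hZ.measurableSet_eventually_isAncestor u))
  · have h2 : ∀ᵐ ω ∂ℙ, ω ∉ N := measure_eq_zero_iff_ae_notMem.1 hN
    exact h2.mono hY

end BranchDistribution

/-! ### Proportionality to the weights, and the limit distribution -/

section HarmonicMeasure

open scoped ENNReal

variable {G : Type*} [AddCommGroup G] [TopologicalSpace G] {𝒢 : BallFiltration G}
  [IsTopologicalAddGroup G] [MeasurableSpace G] [BorelSpace G] {F : Measure G}
  {s : 𝒢.Vertex} {Ω : Type*} [MeasurableSpace Ω] {ℙ : Measure Ω} {Z : ℕ → Ω → 𝒢.Vertex}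

/-- The descendants of `u` in the horocycle `h` which belong to the same subtree `T_k` as `u`. -/
def descendants (u : 𝒢.Vertex) (h : ℤ) : Set 𝒢.Vertex :=
  {v | v.branch = u.branch ∧ u.IsAncestor v ∧ v.hor = h}

lemma mem_descendants_of_mem_children {u v w : 𝒢.Vertex} {h : ℤ} (hh : u.hor < h)
    (hw : w ∈ children v) : w ∈ descendants u h ↔ v ∈ descendants u (h - 1) := by
  have h1 := hor_of_mem_children hw
  rw [descendants, Set.mem_ofPred_eq, descendants, Set.mem_ofPred_eq, branch_of_mem_children hw]
  constructor
  · rintro ⟨ha, hb, hc⟩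
    refine ⟨ha, ?_, by omega⟩
    rwa [← hw.1, isAncestor_pred_iff (by omega)]
  · rintro ⟨ha, hb, hc⟩
    refine ⟨ha, ?_, by omega⟩
    rwa [← hw.1, isAncestor_pred_iff (by omega)] at hb

/-- The bound on `u.branch` excludes the entry from another subtree: the predecessor of `o (h + 1)`
is `o h`, which lies in T_h. -/
lemma pred_mem_descendants_iff {u v : 𝒢.Vertex} {h : ℤ} (hu : u.branch < h) (hh : u.hor ≤ h) :
    v.pred ∈ descendants u h ↔ v ∈ descendants u (h + 1) := by
  rw [descendants, Set.mem_ofPred_eq, descendants, Set.mem_ofPred_eq]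
  by_cases hv : v.hor = h + 1
  · rw [isAncestor_pred_iff (by omega), hor_pred, hv]
    by_cases ho : v = 𝒢.o v.hor
    · have h1 := branch_eq_hor_iff.2 ho
      have h2 := branch_pred_of_eq h1
      constructor <;> rintro ⟨h3, -⟩ <;> omega
    · rw [branch_pred ho]
      simp
  · rw [hor_pred]
    constructor <;> rintro ⟨-, -, h3⟩ <;> omega

section

variable (hfin : ∀ k : ℤ, F ((𝒢.sub k : Set G)ᶜ) < ⊤) (hpos : ∀ k : ℤ, 0 < 𝒢.a F k)

include hfin hpos in
lemma step_indicator_descendants {u : 𝒢.Vertex} {h : ℤ} (hh : u.hor < h) (v : 𝒢.Vertex) :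
    𝒢.step F ((descendants u h).indicator 1) v =
      ENNReal.ofReal (𝒢.up F u.branch) * (descendants u (h + 1)).indicator 1 v +
        ENNReal.ofReal (𝒢.down F u.branch) * (descendants u (h - 1)).indicator 1 v := by
  classical
  have hle := branch_le_hor u
  rw [step_of_children_eq hfin hpos (c := (descendants u (h - 1)).indicator 1 v)
    (fun w hw => by
      simp only [Set.indicator_apply, mem_descendants_of_mem_children hh hw, Pi.one_apply])]
  simp only [Set.indicator_apply, pred_mem_descendants_iff (hle.trans_lt hh) hh.le, Pi.one_apply]
  congr 1
  · split_ifs with h1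
    · rw [h1.1]
    · simp
  · split_ifs with h1
    · rw [h1.1]
    · simp

/-- On its own horocycle u is its only descendant, so it is entered from its children or from its
predecessor alone. Only here does the individual probability `p u.pred u` appear. -/
lemma step_indicator_descendants_hor {u : 𝒢.Vertex} (hu : u ≠ 𝒢.o u.hor) (v : 𝒢.Vertex) :
    𝒢.step F ((descendants u u.hor).indicator 1) v =
      ENNReal.ofReal (𝒢.up F u.branch) * (descendants u (u.hor + 1)).indicator 1 v +
        ENNReal.ofReal (𝒢.p F u.pred u) * (descendants u.pred (u.hor - 1)).indicator 1 v := by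
  classical
  have hlt : u.branch < u.hor := lt_of_le_of_ne (branch_le_hor u) (mt branch_eq_hor_iff.1 hu)
  have h1 : ∀ w : 𝒢.Vertex, ∀ z : 𝒢.Vertex, z ∈ descendants w w.hor ↔ z = w := by
    intro w z
    constructor
    · rintro ⟨-, h2, h3⟩
      exact ((isAncestor_iff_eq h3.symm).1 h2).symm
    · rintro rfl
      exact ⟨rfl, isAncestor_refl _, rfl⟩
  rw [step_eq]
  simp only [Set.indicator_apply, pred_mem_descendants_iff hlt le_rfl, Pi.one_apply]
  rw [← hor_pred u]
  simp only [h1]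
  congr 1
  · split_ifs with h2
    · rw [h2.1]
    · simp
  · simp only [mul_ite, mul_one, mul_zero, Finset.sum_ite_eq', Set.Finite.mem_toFinset]
    by_cases hv : v = u.pred
    · rw [if_pos hv, if_pos ⟨hv.symm, hu⟩, hv]
    · rw [if_neg hv, if_neg fun h2 => hv h2.1.symm]

lemma IsWalk.measure_descendants_zero {n : ℤ} (hZ : 𝒢.IsWalk F (𝒢.o n) ℙ Z) {u : 𝒢.Vertex} {h : ℤ}
    (hh : u.branch < h) : ℙ {ω | Z 0 ω ∈ descendants u h} = 0 := by
  rw [measure_eq_zero_iff_ae_notMem]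
  filter_upwards [hZ.ae_zero_eq] with ω hω h1
  have h2 : Z 0 ω ∈ descendants u h := h1
  rw [hω] at h2
  obtain ⟨h3, -, h4⟩ := h2
  rw [branch_o] at h3
  rw [hor_o] at h4
  omega

include hfin hpos in
lemma IsWalk.measure_descendants_succ (hZ : 𝒢.IsWalk F s ℙ Z) {u : 𝒢.Vertex} {h : ℤ}
    (hh : u.hor < h) (m : ℕ) : ℙ {ω | Z (m + 1) ω ∈ descendants u h} =
      ENNReal.ofReal (𝒢.up F u.branch) * ℙ {ω | Z m ω ∈ descendants u (h + 1)} +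
        ENNReal.ofReal (𝒢.down F u.branch) * ℙ {ω | Z m ω ∈ descendants u (h - 1)} := by
  rw [← hZ.lintegral_indicator_one, hZ.lintegral_succ]
  simp only [step_indicator_descendants hfin hpos hh]
  rw [lintegral_add_left (hZ.measurable_comp (fun v => _ * _) m),
    lintegral_const_mul _ (hZ.measurable_comp _ m), lintegral_const_mul _ (hZ.measurable_comp _ m),
    hZ.lintegral_indicator_one, hZ.lintegral_indicator_one]

lemma IsWalk.measure_descendants_hor_succ (hZ : 𝒢.IsWalk F s ℙ Z) {u : 𝒢.Vertex}
    (hu : u ≠ 𝒢.o u.hor) (m : ℕ) : ℙ {ω | Z (m + 1) ω ∈ descendants u u.hor} =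
      ENNReal.ofReal (𝒢.up F u.branch) * ℙ {ω | Z m ω ∈ descendants u (u.hor + 1)} +
        ENNReal.ofReal (𝒢.p F u.pred u) * ℙ {ω | Z m ω ∈ descendants u.pred (u.hor - 1)} := by
  rw [← hZ.lintegral_indicator_one, hZ.lintegral_succ]
  simp only [step_indicator_descendants_hor hu]
  rw [lintegral_add_left (hZ.measurable_comp (fun v => _ * _) m),
    lintegral_const_mul _ (hZ.measurable_comp _ m), lintegral_const_mul _ (hZ.measurable_comp _ m),
    hZ.lintegral_indicator_one, hZ.lintegral_indicator_one]

include hfin hpos in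
/-- On each horocycle, the distribution of the position of the random walk in `T_k` is proportional to
the weights. -/
lemma IsWalk.weight_mul_measure_descendants {n : ℤ} (hZ : 𝒢.IsWalk F (𝒢.o n) ℙ Z) (m : ℕ) :
    ∀ (u : 𝒢.Vertex) (h : ℤ), u.hor ≤ h →
      ENNReal.ofReal (𝒢.weight F (𝒢.o u.branch)) * ℙ {ω | Z m ω ∈ descendants u h} =
        ENNReal.ofReal (𝒢.weight F u) * ℙ {ω | Z m ω ∈ descendants (𝒢.o u.branch) h} := by
  have htriv : ∀ (m : ℕ) (u : 𝒢.Vertex) (h : ℤ), u = 𝒢.o u.hor →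
      ENNReal.ofReal (𝒢.weight F (𝒢.o u.branch)) * ℙ {ω | Z m ω ∈ descendants u h} =
        ENNReal.ofReal (𝒢.weight F u) * ℙ {ω | Z m ω ∈ descendants (𝒢.o u.branch) h} := by
    intro m u h hu
    have h1 : 𝒢.o u.branch = u := by rw [branch_eq_hor_iff.2 hu, ← hu]
    rw [h1]
  induction m with
  | zero =>
    intro u h hh
    by_cases hu : u = 𝒢.o u.hor
    · exact htriv 0 u h hu
    · have hlt : u.branch < u.hor := lt_of_le_of_ne (branch_le_hor u) (mt branch_eq_hor_iff.1 hu)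
      -- The starting vertex has level equal to its branch, while h exceeds `u.branch`; both sides
      -- vanish.
      rw [hZ.measure_descendants_zero (by omega), hZ.measure_descendants_zero (by rw [branch_o]; omega), mul_zero, mul_zero]
  | succ m ih =>
    intro u h hh
    by_cases hu : u = 𝒢.o u.hor
    · exact htriv _ u h hu
    have hlt : u.branch < u.hor := lt_of_le_of_ne (branch_le_hor u) (mt branch_eq_hor_iff.1 hu)
    rw [hZ.measure_descendants_succ hfin hpos (u := 𝒢.o u.branch) (by rw [hor_o]; omega), branch_o]
    rcases hh.lt_or_eq with hh | rfl
    · rw [hZ.measure_descendants_succ hfin hpos hh, mul_add, mul_add, mul_left_comm, ih u _ (by omega),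
        mul_left_comm _ (ENNReal.ofReal (𝒢.down F u.branch)), ih u _ (by omega)]
      ring
    -- On the horocycle of u itself, the mass coming from above is controlled by the hypothesis for
    -- the predecessor, and `weight_mul_p` converts the weight of the predecessor into that of u.
    · have h1 := ih u.pred (u.hor - 1) le_rfl
      rw [branch_pred hu] at h1
      have h2 : ENNReal.ofReal (𝒢.weight F u.pred) * ENNReal.ofReal (𝒢.p F u.pred u) =
          ENNReal.ofReal (𝒢.weight F u) * ENNReal.ofReal (𝒢.down F u.branch) := by
        rw [← ENNReal.ofReal_mul (weight_nonneg _), ← ENNReal.ofReal_mul (weight_nonneg _),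
          weight_mul_p hfin ⟨rfl, hu⟩, branch_pred hu]
      rw [hZ.measure_descendants_hor_succ hu, mul_add, mul_add, mul_left_comm, ih u _ (by omega),
        mul_left_comm _ (ENNReal.ofReal (𝒢.p F u.pred u)), h1, ← mul_assoc (ENNReal.ofReal
          (𝒢.p F u.pred u)), mul_comm (ENNReal.ofReal (𝒢.p F u.pred u)), h2]
      ring

lemma IsWalk.measure_eq_tsum_descendants (hZ : 𝒢.IsWalk F s ℙ Z) (u : 𝒢.Vertex) (h : ℤ) (m : ℕ) :
    ℙ {ω | Z m ω ∈ {v | v.branch = u.branch ∧ u.IsAncestor v ∧ h ≤ v.hor}} =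
      ∑' j : ℕ, ℙ {ω | Z m ω ∈ descendants u (h + j)} := by
  have h1 : {ω | Z m ω ∈ {v | v.branch = u.branch ∧ u.IsAncestor v ∧ h ≤ v.hor}} =
      ⋃ j : ℕ, {ω | Z m ω ∈ descendants u (h + j)} := by
    ext ω
    simp only [descendants, Set.mem_ofPred_eq, Set.mem_iUnion]
    constructor
    · rintro ⟨h2, h3, h4⟩
      exact ⟨((Z m ω).hor - h).toNat, h2, h3, by omega⟩
    · rintro ⟨j, h2, h3, h4⟩
      exact ⟨h2, h3, by omega⟩
  rw [h1, measure_iUnion _ fun j => hZ.measurableSet _ m]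
  intro i j hij
  refine Set.disjoint_left.2 fun ω h2 h3 => hij ?_
  have h4 : (Z m ω).hor = h + i := h2.2.2
  have h5 : (Z m ω).hor = h + j := h3.2.2
  omega

include hfin hpos in
-- The proportionality is summed over all horocycles from that of u on; the subtracted term is the
-- part of T_k above u's level.
lemma IsWalk.weight_mul_measureReal_isAncestor {n : ℤ} (hZ : 𝒢.IsWalk F (𝒢.o n) ℙ Z)
    {u : 𝒢.Vertex} (hu : u ≠ 𝒢.o u.hor) (m : ℕ) :
    𝒢.weight F (𝒢.o u.branch) * ℙ.real {ω | Z m ω ∈ {v | u.IsAncestor v}} =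
      𝒢.weight F u * (ℙ.real {ω | Z m ω ∈ {v : 𝒢.Vertex | v.branch = u.branch}} -
        ℙ.real {ω | Z m ω ∈ {v : 𝒢.Vertex | v.branch = u.branch ∧ v.hor < u.hor}}) := by
  have := hZ.isProbabilityMeasure
  have h1 : {v | u.IsAncestor v} = {v | v.branch = u.branch ∧ u.IsAncestor v ∧ u.hor ≤ v.hor} := by
    ext v
    exact ⟨fun h => ⟨branch_eq_branch_of_isAncestor h hu, h, h.hor_le⟩, fun h => h.2.1⟩
  have h2 : ℙ.real {ω | Z m ω ∈ {v : 𝒢.Vertex | v.branch = u.branch}} -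
        ℙ.real {ω | Z m ω ∈ {v : 𝒢.Vertex | v.branch = u.branch ∧ v.hor < u.hor}} =
      ℙ.real {ω | Z m ω ∈ {v : 𝒢.Vertex | v.branch = (𝒢.o u.branch).branch ∧
        (𝒢.o u.branch).IsAncestor v ∧ u.hor ≤ v.hor}} := by
    rw [← measureReal_sdiff (fun ω hω => by exact hω.1) (hZ.measurableSet _ m)]
    congr 1
    ext ω
    simp only [Set.mem_ofPred_eq, Set.mem_sdiff, branch_o, o_isAncestor_iff]
    omega
  have h3 : ENNReal.ofReal (𝒢.weight F (𝒢.o u.branch)) * ℙ {ω | Z m ω ∈ {v | u.IsAncestor v}} =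
      ENNReal.ofReal (𝒢.weight F u) * ℙ {ω | Z m ω ∈ {v : 𝒢.Vertex |
        v.branch = (𝒢.o u.branch).branch ∧ (𝒢.o u.branch).IsAncestor v ∧ u.hor ≤ v.hor}} := by
    rw [h1, hZ.measure_eq_tsum_descendants, hZ.measure_eq_tsum_descendants,
      ← ENNReal.tsum_mul_left, ← ENNReal.tsum_mul_left]
    exact tsum_congr fun j => hZ.weight_mul_measure_descendants hfin hpos m u _ (by omega)
  have h4 := congrArg ENNReal.toReal h3
  rw [ENNReal.toReal_mul, ENNReal.toReal_mul, ENNReal.toReal_ofReal (weight_nonneg _),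
    ENNReal.toReal_ofReal (weight_nonneg _)] at h4
  rw [h2]
  exact h4

include hfin in
lemma weight_le_weight_o {u : 𝒢.Vertex} (hu : u ≠ 𝒢.o u.hor) :
    𝒢.weight F u ≤ 𝒢.weight F (𝒢.o u.branch) := by
  rw [weight_of_ne hu, weight_eq]
  refine measureReal_mono ?_ (measure_shell_ne_top hfin _)
  rw [shell_o]
  exact ball_subset_of_branch_eq hu

include hfin hpos in
/-- The random walk ends below the vertex `u` with probability `F(u) / a_n`. -/
lemma IsWalk.tendsto_measureReal_isAncestor {n : ℤ} (hZ : 𝒢.IsWalk F (𝒢.o (n - 1)) ℙ Z)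
    {u : 𝒢.Vertex} (hu : u ≠ 𝒢.o u.hor) (hun : u.branch ≤ n - 1) :
    Tendsto (fun m => ℙ.real {ω | Z m ω ∈ {v | u.IsAncestor v}}) atTop
      (𝓝 (𝒢.weight F u / 𝒢.a F n)) := by
  have := hZ.isProbabilityMeasure
  have ht := hZ.tendsto_measureReal_branch hfin hpos hun
  -- If F(o_k) = 0 then proportionality says nothing, but the walk then ends in T_k with probability
  -- 0, and F(u) = 0 as well.
  rcases (weight_nonneg (F := F) (𝒢.o u.branch)).eq_or_lt' with h0 | h0
  · have h1 : 𝒢.weight F u = 0 :=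
      le_antisymm (h0 ▸ weight_le_weight_o hfin hu) (weight_nonneg u)
    rw [h0, zero_div] at ht
    rw [h1, zero_div]
    exact squeeze_zero (fun m => measureReal_nonneg)
      (fun m => measureReal_mono fun ω hω => branch_eq_branch_of_isAncestor hω hu) ht
  · have h1 : (fun m => ℙ.real {ω | Z m ω ∈ {v | u.IsAncestor v}}) = fun m =>
        𝒢.weight F u / 𝒢.weight F (𝒢.o u.branch) *
          (ℙ.real {ω | Z m ω ∈ {v : 𝒢.Vertex | v.branch = u.branch}} -
        ℙ.real {ω | Z m ω ∈ {v : 𝒢.Vertex | v.branch = u.branch ∧ v.hor < u.hor}}) := by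
      funext m
      rw [div_mul_eq_mul_div, eq_div_iff h0.ne', mul_comm,
        hZ.weight_mul_measureReal_isAncestor hfin hpos hu]
    have h2 := (ht.sub (hZ.tendsto_measureReal_hor_lt hfin hpos u.branch u.hor)).const_mul
      (𝒢.weight F u / 𝒢.weight F (𝒢.o u.branch))
    rw [h1]
    convert h2 using 2
    field_simp
    ring

lemma IsBoundaryLimit.tendsto_measureReal_isAncestor {Y : Ω → G} (hY : 𝒢.IsBoundaryLimit ℙ Z Y)
    (hZ : 𝒢.IsWalk F s ℙ Z) (u : 𝒢.Vertex) :
    Tendsto (fun m => ℙ.real {ω | Z m ω ∈ {v | u.IsAncestor v}}) atTop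
      (𝓝 ((ℙ.map Y).real u.ball)) := by
  rw [map_measureReal_apply hY.measurable (measurableSet_ball u)]
  refine hZ.tendsto_measureReal (hY.measurable (measurableSet_ball u)) ?_
  filter_upwards [hY.ae_converges] with ω hω
  by_cases h : Y ω ∈ u.ball
  · filter_upwards [(convergesTo_iff hω u).1 h] with m hm
    exact iff_of_true hm h
  · filter_upwards [hω u.hor] with m hm
    exact iff_of_false (fun h' => h (mem_ball_iff.2 (eq_of_isAncestor rfl hm h'))) h

end

end HarmonicMeasure

end BallFiltration

theorem mainTheorem1 {G : Type*} [AddCommGroup G] [TopologicalSpace G] [IsTopologicalAddGroup G]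
    [MeasurableSpace G] [BorelSpace G] (𝒢 : BallFiltration G) (F : Measure G)
    (hfin : ∀ k : ℤ, F ((𝒢.sub k : Set G)ᶜ) < ⊤)
    (hpos : ∀ k : ℤ, 0 < 𝒢.a F k)
    (htop : Tendsto (𝒢.a F) atTop atTop)
    (n : ℤ) :
    (∃ ℙ : Measure (ℕ → 𝒢.Vertex), 𝒢.IsWalk F (𝒢.o (n - 1)) ℙ (fun m z => z m)) ∧
    ∀ {Ω : Type*} [MeasurableSpace Ω] (ℙ : Measure Ω) (Z : ℕ → Ω → 𝒢.Vertex),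
      𝒢.IsWalk F (𝒢.o (n - 1)) ℙ Z →
      (∃ Y : Ω → G, 𝒢.IsBoundaryLimit ℙ Z Y ∧ ∀ᵐ ω ∂ℙ, Y ω ≠ 0) ∧
      ∀ Y : Ω → G, 𝒢.IsBoundaryLimit ℙ Z Y →
        ∀ u : 𝒢.Vertex, u.hor = n → u ≠ 𝒢.o n →
          (ℙ.map Y).real u.ball = F.real u.ball / 𝒢.a F n := by
  refine ⟨⟨_, BallFiltration.isWalk_pathMeasure hfin hpos _⟩, fun ℙ Z hZ => ⟨?_, ?_⟩⟩
  · obtain ⟨Y, hY⟩ := hZ.exists_isBoundaryLimit (hZ.ae_exists_convergesTo hfin hpos)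
    refine ⟨Y, hY, ?_⟩
    filter_upwards [hY.ae_converges, hZ.ae_ne_zero] with ω h1 h2 h3
    exact h2 (h3 ▸ h1)
  · intro Y hY u hun hu
    rw [← hun] at hu
    have hlt : u.branch < u.hor :=
      lt_of_le_of_ne (BallFiltration.branch_le_hor u) (mt BallFiltration.branch_eq_hor_iff.1 hu)
    rw [← BallFiltration.weight_of_ne (F := F) hu]
    -- The probability that u is an ancestor of `Z m` has two expressions for its limit. As u is on
    -- horocycle n and differs from `o n`, its branch is at most n - 1.
    exact tendsto_nhds_unique (hY.tendsto_measureReal_isAncestor hZ u)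
      (hZ.tendsto_measureReal_isAncestor hfin hpos hu (by omega))
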